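/- Let $\mathcal S_0$ be a compact smooth manifold of dimension $n$, let $I\subset\mathbb R$ be an open interval, and let $N=I\times\mathcal S_0$ carry the Lorentzian metric $$d\bar s^2=e^{2\psi}\{-(dx^0)^2+\sigma_{ij}(x^0,x)\,dx^i dx^j\},$$ where $x^0\in I$ is the future directed time function, $(x^i)$ are local coordinates of $\mathcal S_0$, $\psi$ is a smooth function on $N$, and $\sigma_{ij}(t,\cdot)$, $t\in I$, is a family of Riemannian metrics on $\mathcal S_0$ that is smooth in $(t,x)$. For $u\in C^2(\mathcal S_0)$ with values in $I$ let $M=\{x^0=u(x):x\in\mathcal S_0\}$ be its graph, put $|Du|^2=\sigma^{ij}(u,x)u_iu_j$, and let the principal curvatures $\kappa_i$ of a spacelike $M$ (i.e. one whose induced metric $g_{ij}$ is Riemannian) be the eigenvalues, with respect to $g_{ij}$, of the second fundamental form $h_{ij}$ defined by the Gauss formula $x^\alpha_{ij}=h_{ij}\nu^\alpha$, where $x_{ij}^\alpha$ is the full covariant derivative and $\nu$ is the past directed unit normal. Then for every compact interval $[a,b]\subset I$ and every $\kappa_0\in\mathbb R$ there is a constant $c$, depending only on $a,b,\mathcal S_0,\sigma_{ij},\psi$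 and $\kappa_0$, such that for every $u\in C^2(\mathcal S_0)$ with $a\le u\le b$ whose graph $M$ is spacelike and whose principal curvatures are bounded from one side by $\kappa_0$, i.e. $$\kappa_i\ge\kappa_0\ \text{ everywhere on } M \text{ for all } i,\qquad\text{or}\qquad \kappa_i\le\kappa_0\ \text{ everywhere on } M\text{ for all } i,$$ one has $|Du|<1$ and $$\tilde v=\frac1{\sqrt{1-|Du|^2}}\le c\qquad\text{on } \mathcal S_0 .$$ -/

import Mathlib

open scoped Manifold ContDiff

noncomputable section

/-- Christoffel symbols of the first kind of a metric `G` given on a coordinate patch of the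
vector space `V`, contracted with `a, b, c`:
`⟨Γ(a, b), c⟩ = ½ (∂_a G(b, c) + ∂_b G(a, c) - ∂_c G(a, b))` at the point `z`. -/
def christoffelFirst {V : Type*} [NormedAddCommGroup V] [NormedSpace ℝ V]
    (G : V → V → V → ℝ) (z a b c : V) : ℝ :=
  (fderiv ℝ (fun z' => G z' b c) z a + fderiv ℝ (fun z' => G z' a c) z b
    - fderiv ℝ (fun z' => G z' a b) z c) / 2

/-- Coordinate expression `g_{ij} = ⟨x_i, x_j⟩` of the metric induced by the map `X`. -/
def inducedMetric {E V : Type*} [NormedAddCommGroup E] [NormedSpace ℝ E]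
    [NormedAddCommGroup V] [NormedSpace ℝ V]
    (G : V → V → V → ℝ) (X : E → V) (y v w : E) : ℝ :=
  G (X y) (fderiv ℝ X y v) (fderiv ℝ X y w)

/-- Coordinate expression of the second fundamental form of a spacelike hypersurface `X` in a
Lorentzian coordinate patch, with respect to the unit normal `ν`.  The Gauss formula
`x_{ij} = h_{ij} ν` (for `⟨ν, ν⟩ = -1`), with
`x_{ij} = x_{,ij} - Γ^k_{ij} x_k + Γ̄(x_i, x_j)`, gives after pairing with `ν`, as
`⟨x_k, ν⟩ = 0`, that `h_{ij} = -⟨x_{,ij} + Γ̄(x_i, x_j), ν⟩`. -/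
def secondFundamentalForm {E V : Type*} [NormedAddCommGroup E] [NormedSpace ℝ E]
    [NormedAddCommGroup V] [NormedSpace ℝ V]
    (G : V → V → V → ℝ) (X : E → V) (ν : V) (y v w : E) : ℝ :=
  -(G (X y) (fderiv ℝ (fderiv ℝ X) y v w) ν
    + christoffelFirst G (X y) (fderiv ℝ X y v) (fderiv ℝ X y w) ν)

/-- The data of a Lorentzian manifold `N = I × S` in Gaussian coordinates: an open interval `I`,
a smooth function `ψ` on `I × S` and a smooth family `σ t`, `t ∈ I`, of Riemannian metrics on the
`n`-dimensional manifold `S`.  (Values of `ψ` and `σ` outside `I` are irrelevant.) -/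
structure GaussianSpacetime (n : ℕ) (S : Type*) [TopologicalSpace S]
    [ChartedSpace (EuclideanSpace ℝ (Fin n)) S] [IsManifold (𝓡 n) ∞ S] where
  /-- the range of the time function `x⁰` -/
  I : Set ℝ
  isOpen_I : IsOpen I
  ordConnected_I : I.OrdConnected
  /-- the conformal exponent -/
  ψ : ℝ → S → ℝ
  /-- the metrics `σ_{ij}(x⁰, x) dxⁱ dxʲ` -/
  σ : ℝ → (x : S) → TangentSpace (𝓡 n) x →L[ℝ] TangentSpace (𝓡 n) x →L[ℝ] ℝ
  contMDiffOn_ψ : ContMDiffOn (𝓘(ℝ, ℝ).prod (𝓡 n)) 𝓘(ℝ, ℝ) ∞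
    (fun z : ℝ × S => ψ z.1 z.2) (I ×ˢ Set.univ)
  contMDiffOn_σ : ContMDiffOn (𝓘(ℝ, ℝ).prod (𝓡 n))
    ((𝓡 n).prod 𝓘(ℝ, EuclideanSpace ℝ (Fin n) →L[ℝ] EuclideanSpace ℝ (Fin n) →L[ℝ] ℝ)) ∞
    (fun z : ℝ × S => Bundle.TotalSpace.mk'
      (E := fun x : S => TangentSpace (𝓡 n) x →L[ℝ] TangentSpace (𝓡 n) x →L[ℝ] ℝ)
      (EuclideanSpace ℝ (Fin n) →L[ℝ] EuclideanSpace ℝ (Fin n) →L[ℝ] ℝ) z.2 (σ z.1 z.2))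
    (I ×ˢ Set.univ)
  σ_symm : ∀ t ∈ I, ∀ (x : S) (v w : TangentSpace (𝓡 n) x), σ t x v w = σ t x w v
  σ_pos : ∀ t ∈ I, ∀ (x : S) (v : TangentSpace (𝓡 n) x), v ≠ 0 → 0 < σ t x v v

namespace GaussianSpacetime

variable {n : ℕ} {S : Type*} [TopologicalSpace S]
  [ChartedSpace (EuclideanSpace ℝ (Fin n)) S] [IsManifold (𝓡 n) ∞ S]

/-- The Lorentzian metric `e^{2ψ} (-(dx⁰)² + σ_{ij}(x⁰, x) dxⁱ dxʲ)` at the point `(t, x)`. -/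
def metric (N : GaussianSpacetime n S) (t : ℝ) (x : S)
    (a b : ℝ × TangentSpace (𝓡 n) x) : ℝ :=
  Real.exp (2 * N.ψ t x) * (-(a.1 * b.1) + N.σ t x a.2 b.2)

/-- The differential at `y` of the inverse of the chart at `p`; it maps the `i`-th basis vector to
the coordinate vector `∂/∂xⁱ`. -/
def chartFrame (p : S) (y : EuclideanSpace ℝ (Fin n)) :
    EuclideanSpace ℝ (Fin n) →L[ℝ] TangentSpace (𝓡 n) ((extChartAt (𝓡 n) p).symm y) :=
  mfderiv 𝓘(ℝ, EuclideanSpace ℝ (Fin n)) (𝓡 n) (extChartAt (𝓡 n) p).symm y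

/-- The components of the Lorentzian metric in the Gaussian coordinates `(x⁰, xⁱ)`, where `(xⁱ)`
are the local coordinates of `S` given by the chart at `p`. -/
def coordMetric (N : GaussianSpacetime n S) (p : S)
    (z a b : ℝ × EuclideanSpace ℝ (Fin n)) : ℝ :=
  N.metric z.1 ((extChartAt (𝓡 n) p).symm z.2)
    (a.1, chartFrame p z.2 a.2) (b.1, chartFrame p z.2 b.2)

/-- The embedding `x ↦ (u(x), x)` of the graph of `u`, in Gaussian coordinates around `p`. -/
def coordGraph (n : ℕ) {S : Type*} [TopologicalSpace S]
    [ChartedSpace (EuclideanSpace ℝ (Fin n)) S] (u : S → ℝ) (p : S)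
    (y : EuclideanSpace ℝ (Fin n)) : ℝ × EuclideanSpace ℝ (Fin n) :=
  (u ((extChartAt (𝓡 n) p).symm y), y)

/-- `graph u` is spacelike: its induced metric is Riemannian. -/
def IsSpacelikeGraph (N : GaussianSpacetime n S) (u : S → ℝ) : Prop :=
  ∀ (p : S) (v : EuclideanSpace ℝ (Fin n)), v ≠ 0 →
    0 < inducedMetric (N.coordMetric p) (coordGraph n u p) (extChartAt (𝓡 n) p p) v v

/-- `ν` is the past directed unit normal of `graph u` over the point `p`. -/
def IsPastNormal (N : GaussianSpacetime n S) (u : S → ℝ) (p : S)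
    (ν : ℝ × EuclideanSpace ℝ (Fin n)) : Prop :=
  let y := extChartAt (𝓡 n) p p
  (∀ v, N.coordMetric p (coordGraph n u p y) ν (fderiv ℝ (coordGraph n u p) y v) = 0) ∧
    N.coordMetric p (coordGraph n u p y) ν ν = -1 ∧ ν.1 < 0

/-- `κ` is a principal curvature of `graph u` over the point `p`: an eigenvalue of the second
fundamental form, taken with respect to the past directed unit normal, relative to the induced
metric. -/
def IsPrincipalCurvature (N : GaussianSpacetime n S) (u : S → ℝ) (p : S) (κ : ℝ) : Prop :=
  let y := extChartAt (𝓡 n) p p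
  ∃ ν, N.IsPastNormal u p ν ∧ ∃ v, v ≠ 0 ∧ ∀ w,
    secondFundamentalForm (N.coordMetric p) (coordGraph n u p) ν y v w
      = κ * inducedMetric (N.coordMetric p) (coordGraph n u p) y v w

/-- The coordinate vector `∂/∂xⁱ` at `x` (in the chart at `x`). -/
def coordVec (x : S) (i : Fin n) : TangentSpace (𝓡 n) x :=
  (EuclideanSpace.single i (1 : ℝ) : EuclideanSpace ℝ (Fin n))

/-- The differential `Du` of a function at `x`. -/
def differential (n : ℕ) {S : Type*} [TopologicalSpace S]
    [ChartedSpace (EuclideanSpace ℝ (Fin n)) S] (u : S → ℝ) (x : S) :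
    TangentSpace (𝓡 n) x →L[ℝ] ℝ :=
  mfderiv (𝓡 n) 𝓘(ℝ, ℝ) u x

/-- `|Du|² = σ^{ij}(u, x) u_i u_j` at the point `x`. -/
def gradNormSq (N : GaussianSpacetime n S) (u : S → ℝ) (x : S) : ℝ :=
  let A : Matrix (Fin n) (Fin n) ℝ :=
    Matrix.of fun i j => N.σ (u x) x (coordVec x i) (coordVec x j)
  let du : Fin n → ℝ := fun i => differential n u x (coordVec x i)
  ∑ i, ∑ j, A⁻¹ i j * du i * du j

/-- `ṽ = 1 / √(1 - |Du|²)` at the point `x`. -/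
def tiltFactor (N : GaussianSpacetime n S) (u : S → ℝ) (x : S) : ℝ :=
  1 / √(1 - N.gradNormSq u x)

end GaussianSpacetime

end

/-! Maximum principle for the first order quantity `(1 - |Du|²) e^{-2λu}`, where `λ = ±(2C + 1)`,
`C` bounds `ψ` and the relevant first derivatives of `ψ` and `σ` over `[a, b] × S`, and the sign is
that of the curvature condition. By compactness it has a minimum point `p`. Let `ξ` be the gradient
of `u` at `p` with respect to `σ(u, ·)`, and `q = |Du|² = Du(ξ)`.

Freeze `ξ` as a constant vector in the chart at `p`. By Cauchy–Schwarz `Du(ξ)² / σ(ξ, ξ) ≤ |Du|²`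
near `p`, with equality at `p`, so replacing `|Du|²` by this quotient keeps the minimum at `p` and
avoids differentiating the inverse matrix `σ^{ij}`. The vanishing derivative along `ξ` determines
`D²u(ξ, ξ)` (`fderiv_fderiv_gradient_of_isLocalMin`).

Inserted into the second fundamental form (`graphForm_gradient`), this makes `h(ξ, ξ)` a multiple of
`1 - q`, as is `g(ξ, ξ) = e^{2ψ}(1 - q)q`. With `k = e^{-ψ}/√(1 - q)`, the one-sided bound `±h ≤ κ₁
g` becomes `k((2C + 1)q - error) ≤ κ₁ q` with error at most `2Cq`, whence `k ≤ κ₁`: a bound for `ṽ`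
at `p`. Minimality of `p` and `a ≤ u ≤ b` carry it to all of `S`. -/

/-! ### Eigenvalue bounds and quadratic forms. -/

section PositiveForms

variable {E : Type*} [NormedAddCommGroup E] [NormedSpace ℝ E]

/-- The kernel of a positive semidefinite symmetric bilinear form contains every null vector. -/
theorem LinearMap.apply_eq_zero_of_apply_self_eq_zero {E : Type*} [AddCommGroup E] [Module ℝ E]
    (B : E →ₗ[ℝ] E →ₗ[ℝ] ℝ) (hsymm : ∀ v w, B v w = B w v) (hB : ∀ v, 0 ≤ B v v)
    {v : E} (hv : B v v = 0) (w : E) : B v w = 0 := by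
  by_contra hne
  have key : ∀ t : ℝ, 0 ≤ 2 * t * B v w + B w w := fun t ↦ by
    have := hB (t • v + w)
    simp only [map_add, map_smul, LinearMap.add_apply, LinearMap.smul_apply, smul_eq_mul, hv,
      hsymm w v] at this
    linarith
  -- The parameter at which the affine function in `key` takes the value `-1`.
  have := key (-(B w w + 1) / (2 * B v w))
  rw [show 2 * (-(B w w + 1) / (2 * B v w)) * B v w = -(B w w + 1) by field_simp] at this
  linarith

/-- If all eigenvalues of `h` relative to `g` are at most `κ₀`, then `h ≤ κ₀ g`. -/
theorem LinearMap.apply_self_le_of_eigenvalues_le [FiniteDimensional ℝ E]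
    (g h : E →ₗ[ℝ] E →ₗ[ℝ] ℝ) (gsymm : ∀ v w, g v w = g w v) (hsymm : ∀ v w, h v w = h w v)
    (gpos : ∀ v, v ≠ 0 → 0 < g v v) (κ₀ : ℝ)
    (hκ : ∀ κ v, v ≠ 0 → (∀ w, h v w = κ * g v w) → κ ≤ κ₀) (v : E) :
    h v v ≤ κ₀ * g v v := by
  rcases eq_or_ne v 0 with rfl | hv
  · simp
  have cont : ∀ B : E →ₗ[ℝ] E →ₗ[ℝ] ℝ, Continuous fun w ↦ B w w := fun B ↦ by
    let B' : E →L[ℝ] E →L[ℝ] ℝ :=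
      LinearMap.toContinuousLinearMap ((LinearMap.toContinuousLinearMap :
        (E →ₗ[ℝ] ℝ) ≃ₗ[ℝ] (E →L[ℝ] ℝ)).toLinearMap ∘ₗ B)
    exact (B'.continuous.clm_apply continuous_id : Continuous fun w ↦ B' w w)
  have hnv : ‖v‖ ≠ 0 := norm_ne_zero_iff.2 hv
  have hunit : ‖v‖⁻¹ • v ∈ Metric.sphere (0 : E) 1 := by
    simp [norm_smul, hnv]
  have hne : ∀ w ∈ Metric.sphere (0 : E) 1, w ≠ 0 := fun w hw ↦
    ne_zero_of_mem_unit_sphere ⟨w, hw⟩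
  have : ProperSpace E := FiniteDimensional.proper ℝ E
  -- The Rayleigh quotient `h/g` is homogeneous of degree zero, so its maximum over the compact unit
  -- sphere is global.
  obtain ⟨m, hm, hmax⟩ := (isCompact_sphere (0 : E) 1).exists_isMaxOn ⟨_, hunit⟩
    (f := fun w ↦ h w w / g w w)
    ((cont h).continuousOn.div (cont g).continuousOn fun w hw ↦ (gpos w (hne w hw)).ne')
  set μ := h m m / g m m with hμ
  have hle : ∀ w, w ≠ 0 → h w w ≤ μ * g w w := fun w hw ↦ by
    have hnw : ‖w‖ ≠ 0 := norm_ne_zero_iff.2 hw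
    have h1 : ‖w‖⁻¹ • w ∈ Metric.sphere (0 : E) 1 := by simp [norm_smul, hnw]
    have h2 := hmax h1
    simp only [Set.mem_ofPred_eq, map_smul, LinearMap.smul_apply, smul_eq_mul] at h2
    rw [mul_div_mul_left _ _ (inv_ne_zero hnw), mul_div_mul_left _ _ (inv_ne_zero hnw)] at h2
    exact (div_le_iff₀ (gpos w hw)).1 h2
  have hgm := gpos m (hne m hm)
  -- `μ g - h` is positive semidefinite with null vector `m`; hence `m` lies in its kernel and is an
  -- eigenvector for `μ`.
  have hker := LinearMap.apply_eq_zero_of_apply_self_eq_zero (μ • g - h)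
    (fun v w ↦ by simp [gsymm v w, hsymm v w])
    (fun w ↦ by
      rcases eq_or_ne w 0 with rfl | hw
      · simp
      · simpa using hle w hw) (v := m) (by simp [hμ, hgm.ne'])
  have hμκ : μ ≤ κ₀ := hκ μ m (hne m hm) fun w ↦ by
    have := hker w
    simp only [LinearMap.sub_apply, LinearMap.smul_apply, smul_eq_mul] at this
    linarith
  exact (hle v hv).trans (mul_le_mul_of_nonneg_right hμκ (gpos v hv).le)

end PositiveForms

/-! ### Geometry of a graph in one coordinate patch. -/

section LocalComputation

variable {E : Type*} [NormedAddCommGroup E] [NormedSpace ℝ E]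

/-- The metric `e^{2P} (-dt² + s)` on `ℝ × E`. -/
noncomputable def conformalMetric (P : ℝ × E → ℝ) (s : ℝ × E → E →L[ℝ] E →L[ℝ] ℝ)
    (z a b : ℝ × E) : ℝ :=
  Real.exp (2 * P z) * (-(a.1 * b.1) + s z a.2 b.2)

variable {P : ℝ × E → ℝ} {s : ℝ × E → E →L[ℝ] E →L[ℝ] ℝ} {U : E → ℝ} {z : ℝ × E} {y : E}

theorem fderiv_conformalMetric (hP : DifferentiableAt ℝ P z) (hs : DifferentiableAt ℝ s z)
    (a b c : ℝ × E) :
    fderiv ℝ (fun z' ↦ conformalMetric P s z' a b) z c =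
      2 * fderiv ℝ P z c * conformalMetric P s z a b
        + Real.exp (2 * P z) * fderiv ℝ s z c a.2 b.2 := by
  have h1 := ((hP.hasFDerivAt.const_mul 2).exp).mul
    ((((hs.hasFDerivAt.clm_apply (hasFDerivAt_const a.2 z)).clm_apply
      (hasFDerivAt_const b.2 z))).const_add (-(a.1 * b.1)))
  have h2 := h1.fderiv
  have h3 : (fun z' ↦ conformalMetric P s z' a b) = (fun z' ↦ Real.exp (2 * P z')) *
    (fun z' ↦ -(a.1 * b.1) + s z' a.2 b.2) := rfl
  rw [h3, h2]
  simp [conformalMetric]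
  ring

theorem fderiv_graph (hU : DifferentiableAt ℝ U y) (v : E) :
    fderiv ℝ (fun y ↦ (U y, y)) y v = (fderiv ℝ U y v, v) := by
  have h : HasFDerivAt (fun y ↦ (U y, y)) _ y := hU.hasFDerivAt.prodMk (hasFDerivAt_id y)
  rw [h.fderiv]
  rfl

theorem fderiv_fderiv_graph (hU : ContDiffAt ℝ 2 U y) (v w : E) :
    fderiv ℝ (fderiv ℝ (fun y ↦ (U y, y))) y v w = (fderiv ℝ (fderiv ℝ U) y v w, 0) := by
  have hev : fderiv ℝ (fun y ↦ (U y, y)) =ᶠ[nhds y]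
      fun y' ↦ (fderiv ℝ U y').prod (ContinuousLinearMap.id ℝ E) := by
    filter_upwards [hU.eventually (by simp)] with y' hy'
    ext1 v
    exact fderiv_graph (hy'.differentiableAt (by simp)) v
  have hd : DifferentiableAt ℝ (fderiv ℝ U) y :=
    (hU.fderiv_right (m := 1) (by norm_num)).differentiableAt (by simp)
  have hc : HasFDerivAt (fun y' ↦ (fderiv ℝ U y').prod (ContinuousLinearMap.id ℝ E))
      (((ContinuousLinearMap.compL ℝ E ℝ (ℝ × E) (ContinuousLinearMap.inl ℝ ℝ E))).comp
        (fderiv ℝ (fderiv ℝ U) y)) y := by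
    have := (((ContinuousLinearMap.compL ℝ E ℝ (ℝ × E)
      (ContinuousLinearMap.inl ℝ ℝ E))).hasFDerivAt.comp y hd.hasFDerivAt).add_const
      ((ContinuousLinearMap.inr ℝ ℝ E))
    convert! this using 2 with y'
    ext <;> simp
  rw [hev.fderiv_eq, hc.fderiv]
  simp

theorem christoffelFirst_conformalMetric (hP : DifferentiableAt ℝ P z)
    (hs : DifferentiableAt ℝ s z) (a b c : ℝ × E) :
    christoffelFirst (conformalMetric P s) z a b c =
      fderiv ℝ P z a * conformalMetric P s z b c + fderiv ℝ P z b * conformalMetric P s z a c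
        - fderiv ℝ P z c * conformalMetric P s z a b
        + Real.exp (2 * P z) / 2 * (fderiv ℝ s z a b.2 c.2 + fderiv ℝ s z b a.2 c.2
          - fderiv ℝ s z c a.2 b.2) := by
  simp only [christoffelFirst, fderiv_conformalMetric hP hs]
  ring

/-- Symmetry is assumed only near `z`, since nothing is known about `σ` for times outside `I`. -/
theorem fderiv_symm_of_eventually (hs : DifferentiableAt ℝ s z)
    (hsymm : ∀ᶠ z' in nhds z, ∀ v w, s z' v w = s z' w v) (c : ℝ × E) (v w : E) :
    fderiv ℝ s z c v w = fderiv ℝ s z c w v := by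
  have key : ∀ v w, fderiv ℝ s z c v w = fderiv ℝ (fun z' ↦ s z' v w) z c := fun v w ↦ by
    rw [((hs.hasFDerivAt.clm_apply (hasFDerivAt_const v z)).clm_apply
      (hasFDerivAt_const w z)).fderiv]
    simp
  have hev : (fun z' ↦ s z' v w) =ᶠ[nhds z] fun z' ↦ s z' w v := by
    filter_upwards [hsymm] with z' h using h v w
  rw [key, key, hev.fderiv_eq]

/-- The induced metric of a graph as a bilinear form. -/
noncomputable def graphMetric (P : ℝ × E → ℝ) (s : ℝ × E → E →L[ℝ] E →L[ℝ] ℝ) (z : ℝ × E)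
    (l : E →L[ℝ] ℝ) : E →ₗ[ℝ] E →ₗ[ℝ] ℝ :=
  LinearMap.mk₂ ℝ (fun v w ↦ conformalMetric P s z (l v, v) (l w, w))
    (by intros; simp [conformalMetric]; ring) (by intros; simp [conformalMetric]; ring)
    (by intros; simp [conformalMetric]; ring) (by intros; simp [conformalMetric]; ring)

theorem inducedMetric_graph (hU : DifferentiableAt ℝ U y) (v w : E) :
    inducedMetric (conformalMetric P s) (fun y ↦ (U y, y)) y v w =
      graphMetric P s (U y, y) (fderiv ℝ U y) v w := by
  simp [inducedMetric, graphMetric, fderiv_graph hU]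

/-- The second fundamental form of a graph as a bilinear form. -/
noncomputable def graphForm (P : ℝ × E → ℝ) (s : ℝ × E → E →L[ℝ] E →L[ℝ] ℝ) (z : ℝ × E)
    (l : E →L[ℝ] ℝ) (D : E →L[ℝ] E →L[ℝ] ℝ) (ν : ℝ × E) : E →ₗ[ℝ] E →ₗ[ℝ] ℝ :=
  LinearMap.mk₂ ℝ (fun v w ↦ Real.exp (2 * P z) * D v w * ν.1
      - (fderiv ℝ P z (l v, v) * conformalMetric P s z (l w, w) ν
        + fderiv ℝ P z (l w, w) * conformalMetric P s z (l v, v) ν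
        - fderiv ℝ P z ν * conformalMetric P s z (l v, v) (l w, w)
        + Real.exp (2 * P z) / 2 * (fderiv ℝ s z (l v, v) w ν.2 + fderiv ℝ s z (l w, w) v ν.2
          - fderiv ℝ s z ν v w)))
    (by
      intro v v' w
      have h : (l (v + v'), v + v') = (l v, v) + (l v', v') := by simp
      rw [h]
      simp only [conformalMetric, map_add, add_apply, Prod.fst_add,
        Prod.snd_add]
      ring)
    (by
      intro c v w
      have h : (l (c • v), c • v) = c • (l v, v) := by simp
      rw [h]
      simp only [conformalMetric, map_smul, smul_apply, Prod.smul_fst,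
        Prod.smul_snd, smul_eq_mul]
      ring)
    (by
      intro v w w'
      have h : (l (w + w'), w + w') = (l w, w) + (l w', w') := by simp
      rw [h]
      simp only [conformalMetric, map_add, add_apply, Prod.fst_add,
        Prod.snd_add]
      ring)
    (by
      intro c v w
      have h : (l (c • w), c • w) = c • (l w, w) := by simp
      rw [h]
      simp only [conformalMetric, map_smul, smul_apply, Prod.smul_fst,
        Prod.smul_snd, smul_eq_mul]
      ring)

theorem secondFundamentalForm_graph (hP : DifferentiableAt ℝ P (U y, y))
    (hs : DifferentiableAt ℝ s (U y, y)) (hU : ContDiffAt ℝ 2 U y) (ν : ℝ × E) (v w : E) :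
    secondFundamentalForm (conformalMetric P s) (fun y ↦ (U y, y)) ν y v w =
      graphForm P s (U y, y) (fderiv ℝ U y) (fderiv ℝ (fderiv ℝ U) y) ν v w := by
  have hU' : DifferentiableAt ℝ U y := hU.differentiableAt (by simp)
  simp only [secondFundamentalForm, graphForm, fderiv_graph hU', fderiv_fderiv_graph hU,
    christoffelFirst_conformalMetric hP hs, LinearMap.mk₂_apply]
  simp only [conformalMetric, map_zero, zero_apply]
  ring

theorem graphForm_symm (hs : DifferentiableAt ℝ s z)
    (hsymm : ∀ᶠ z' in nhds z, ∀ v w, s z' v w = s z' w v) (l : E →L[ℝ] ℝ)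
    {D : E →L[ℝ] E →L[ℝ] ℝ} (hD : ∀ v w, D v w = D w v) (ν : ℝ × E) (v w : E) :
    graphForm P s z l D ν v w = graphForm P s z l D ν w v := by
  have h1 := hsymm.self_of_nhds v w
  simp only [graphForm, LinearMap.mk₂_apply, hD v w, fderiv_symm_of_eventually hs hsymm ν v w,
    conformalMetric, h1]
  ring

/-- The past directed unit normal of a graph with differential dual to `ξ`, where
`q = |Du|²`. -/
noncomputable def graphNormal (P : ℝ × E → ℝ) (z : ℝ × E) (ξ : E) (q : ℝ) : ℝ × E :=
  -(Real.exp (-P z) / √(1 - q)) • (1, ξ)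

theorem conformalMetric_graphNormal {l : E →L[ℝ] ℝ} {ξ : E} {q : ℝ}
    (hξ : ∀ w, s z ξ w = l w) (v : E) :
    conformalMetric P s z (graphNormal P z ξ q) (l v, v) = 0 := by
  simp [conformalMetric, graphNormal, hξ]

theorem conformalMetric_graphNormal_self {l : E →L[ℝ] ℝ} {ξ : E}
    (hξ : ∀ w, s z ξ w = l w) (hq : l ξ < 1) :
    conformalMetric P s z (graphNormal P z ξ (l ξ)) (graphNormal P z ξ (l ξ)) = -1 := by
  have h1 : √(1 - l ξ) ^ 2 = 1 - l ξ := Real.sq_sqrt (by linarith)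
  have h2 : √(1 - l ξ) ≠ 0 := (Real.sqrt_pos.2 (by linarith)).ne'
  have h3 : Real.exp (2 * P z) * Real.exp (-P z) ^ 2 = 1 := by
    rw [← Real.exp_nat_mul, ← Real.exp_add]; simp
  have : conformalMetric P s z (graphNormal P z ξ (l ξ)) (graphNormal P z ξ (l ξ)) =
      -(Real.exp (2 * P z) * Real.exp (-P z) ^ 2) * (1 - l ξ) / √(1 - l ξ) ^ 2 := by
    simp [conformalMetric, graphNormal, hξ]
    field_simp
    ring
  rw [this, h3, h1]
  field_simp
  rw [div_self (by linarith)]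

/-- The second fundamental form of a graph in the direction of its gradient, at a critical point
of `(1 - |Du|²) e^{-2λu}`. -/
theorem graphForm_gradient {l : E →L[ℝ] ℝ} {D : E →L[ℝ] E →L[ℝ] ℝ} {ξ : E} {lam : ℝ}
    (hsymm : ∀ v w, s z v w = s z w v)
    (hξ : ∀ w, s z ξ w = l w)
    (hD : 2 * D ξ ξ = fderiv ℝ s z (l ξ, ξ) ξ ξ - 2 * lam * (1 - l ξ) * l ξ) :
    graphForm P s z l D (graphNormal P z ξ (l ξ)) ξ ξ =
      -(Real.exp (-P z) / √(1 - l ξ)) * Real.exp (2 * P z) * (1 - l ξ) *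
        (fderiv ℝ s z (1, 0) ξ ξ / 2 - lam * l ξ + fderiv ℝ P z (1, ξ) * l ξ) := by
  have hv := conformalMetric_graphNormal (P := P) (q := l ξ) hξ ξ
  have hv' : conformalMetric P s z (l ξ, ξ) (graphNormal P z ξ (l ξ)) = 0 := by
    rw [← hv]; simp only [conformalMetric, hsymm ξ]; ring
  simp only [graphForm, LinearMap.mk₂_apply, hv']
  set k := Real.exp (-P z) / √(1 - l ξ) with hk
  have e1 : graphNormal P z ξ (l ξ) = (-k) • (1, ξ) := rfl
  -- Splits the tangent vector along the normal direction `(1, ξ)` and the time direction. The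
  -- derivatives of `s` along `(1, ξ)` then cancel between the Hessian and the Christoffel terms,
  -- leaving a common factor `1 - l ξ`.
  have e2 : ((l ξ, ξ) : ℝ × E) = (1, ξ) - (1 - l ξ) • (1, 0) := by simp
  have e3 : fderiv ℝ s z (l ξ, ξ) ξ ξ
      = fderiv ℝ s z (1, ξ) ξ ξ - (1 - l ξ) * fderiv ℝ s z (1, 0) ξ ξ := by
    rw [e2, map_sub, map_smul]; simp
  rw [e3] at hD
  have e4 : D ξ ξ = (fderiv ℝ s z (1, ξ) ξ ξ - (1 - l ξ) * fderiv ℝ s z (1, 0) ξ ξ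
    - 2 * lam * (1 - l ξ) * l ξ) / 2 := by linarith
  rw [e1, e4]
  simp only [conformalMetric, map_smul, smul_apply, Prod.smul_fst,
        Prod.smul_snd, smul_eq_mul, hξ]
  rw [e3]
  ring

/-- The first order condition along the line `y + tξ` with `ξ` constant. At `t = 0` both `DU(ξ)` and
`s(ξ, ξ)` equal `|DU|²`, so the derivative of the quotient collapses to `2 D²U(ξ, ξ)` minus the
derivative of `s(ξ, ξ)`. -/
theorem fderiv_fderiv_gradient_of_isLocalMin {ξ : E} {lam : ℝ} (hU : ContDiffAt ℝ 2 U y)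
    (hs : DifferentiableAt ℝ s (U y, y)) (hξ : ∀ w, s (U y, y) ξ w = fderiv ℝ U y w)
    (hq : 0 < fderiv ℝ U y ξ)
    (hmin : IsLocalMin (fun y' ↦ (1 - fderiv ℝ U y' ξ ^ 2 / s (U y', y') ξ ξ) *
      Real.exp (-2 * lam * U y')) y) :
    2 * fderiv ℝ (fderiv ℝ U) y ξ ξ = fderiv ℝ s (U y, y) (fderiv ℝ U y ξ, ξ) ξ ξ
      - 2 * lam * (1 - fderiv ℝ U y ξ) * fderiv ℝ U y ξ := by
  have hU1 : HasFDerivAt U (fderiv ℝ U y) y := (hU.differentiableAt (by simp)).hasFDerivAt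
  have hU2 : HasFDerivAt (fderiv ℝ U) (fderiv ℝ (fderiv ℝ U) y) y :=
    ((hU.fderiv_right (m := 1) (by norm_num)).differentiableAt (by simp)).hasFDerivAt
  have hA := hU2.clm_apply (hasFDerivAt_const ξ y)
  have hsU : HasFDerivAt (fun y' ↦ s (U y', y')) ((fderiv ℝ s (U y, y)).comp
      ((fderiv ℝ U y).prod (ContinuousLinearMap.id ℝ E))) y :=
    HasFDerivAt.comp (g := s) (f := fun y' ↦ (U y', y')) y hs.hasFDerivAt
      (hU1.prodMk (hasFDerivAt_id y))
  have hB := (hsU.clm_apply (hasFDerivAt_const ξ y)).clm_apply (hasFDerivAt_const ξ y)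
  have hline : HasDerivAt (fun t : ℝ ↦ y + t • ξ) ξ 0 := by
    simpa using ((hasDerivAt_id (0 : ℝ)).smul_const ξ).const_add y
  have hy : y + (0 : ℝ) • ξ = y := by simp
  have dU : HasDerivAt (fun t : ℝ ↦ U (y + t • ξ)) (fderiv ℝ U y ξ) 0 :=
    HasFDerivAt.comp_hasDerivAt_of_eq 0 hU1 hline hy.symm
  have dA : HasDerivAt (fun t : ℝ ↦ fderiv ℝ U (y + t • ξ) ξ) (fderiv ℝ (fderiv ℝ U) y ξ ξ) 0 := by
    exact (HasFDerivAt.comp_hasDerivAt_of_eq 0 hA hline hy.symm).congr_deriv (by simp)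
  have dB : HasDerivAt (fun t : ℝ ↦ s (U (y + t • ξ), y + t • ξ) ξ ξ)
      (fderiv ℝ s (U y, y) (fderiv ℝ U y ξ, ξ) ξ ξ) 0 := by
    exact (HasFDerivAt.comp_hasDerivAt_of_eq 0 hB hline hy.symm).congr_deriv (by simp)
  have hBne : s (U (y + (0 : ℝ) • ξ), y + (0 : ℝ) • ξ) ξ ξ ≠ 0 := by
    rw [hy, hξ]; exact hq.ne'
  have dF := (((dA.pow 2).div dB hBne).const_sub 1).mul ((dU.const_mul (-2 * lam)).exp)
  have hmin' : IsLocalMin (fun t : ℝ ↦ (1 - fderiv ℝ U (y + t • ξ) ξ ^ 2 /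
      s (U (y + t • ξ), y + t • ξ) ξ ξ) * Real.exp (-2 * lam * U (y + t • ξ))) 0 := by
    have : Filter.Tendsto (fun t : ℝ ↦ y + t • ξ) (nhds 0) (nhds y) := by
      simpa using hline.continuousAt.tendsto
    have h := this.eventually hmin
    simpa [IsLocalMin, IsMinFilter] using h
  have h0 := hmin'.hasDerivAt_eq_zero dF
  simp only [zero_smul, add_zero, hξ, Pi.pow_apply, Pi.div_apply] at h0
  have hne := hq.ne'
  field_simp at h0
  rw [mul_zero] at h0
  rcases mul_eq_zero.1 h0 with h | h
  · exact absurd h (Real.exp_pos _).ne'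
  · refine mul_left_cancel₀ hne ?_
    norm_num at h
    linear_combination -h

end LocalComputation

/-! ### Smoothness of the coordinate expressions of `ψ` and `σ`. -/

namespace GaussianSpacetime

variable {n : ℕ} {S : Type*} [TopologicalSpace S]
  [ChartedSpace (EuclideanSpace ℝ (Fin n)) S] [IsManifold (𝓡 n) ∞ S]

/-- The metrics `σ` in the local coordinates given by the chart at `p`. -/
noncomputable def coordSigma (N : GaussianSpacetime n S) (p : S)
    (z : ℝ × EuclideanSpace ℝ (Fin n)) :
    EuclideanSpace ℝ (Fin n) →L[ℝ] EuclideanSpace ℝ (Fin n) →L[ℝ] ℝ :=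
  let σ : EuclideanSpace ℝ (Fin n) →L[ℝ] EuclideanSpace ℝ (Fin n) →L[ℝ] ℝ :=
    N.σ z.1 ((extChartAt (𝓡 n) p).symm z.2)
  let F : EuclideanSpace ℝ (Fin n) →L[ℝ] EuclideanSpace ℝ (Fin n) := chartFrame p z.2
  σ.bilinearComp F F

/-- The function `ψ` in the local coordinates given by the chart at `p`. -/
noncomputable def coordPsi (N : GaussianSpacetime n S) (p : S)
    (z : ℝ × EuclideanSpace ℝ (Fin n)) : ℝ :=
  N.ψ z.1 ((extChartAt (𝓡 n) p).symm z.2)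

theorem coordMetric_eq (N : GaussianSpacetime n S) (p : S) :
    N.coordMetric p = conformalMetric (N.coordPsi p) (N.coordSigma p) := rfl

theorem contMDiffOn_symm_snd (p : S) (I : Set ℝ) :
    ContMDiffOn 𝓘(ℝ, ℝ × EuclideanSpace ℝ (Fin n)) (𝓡 n) ∞
      (fun z : ℝ × EuclideanSpace ℝ (Fin n) ↦ (extChartAt (𝓡 n) p).symm z.2)
      (I ×ˢ (extChartAt (𝓡 n) p).target) :=
  (contMDiffOn_extChartAt_symm p).comp contDiff_snd.contMDiff.contMDiffOn fun _ hz ↦ hz.2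

theorem contMDiffOn_prod_symm (p : S) (I : Set ℝ) :
    ContMDiffOn 𝓘(ℝ, ℝ × EuclideanSpace ℝ (Fin n)) (𝓘(ℝ, ℝ).prod (𝓡 n)) ∞
      (fun z : ℝ × EuclideanSpace ℝ (Fin n) ↦ (z.1, (extChartAt (𝓡 n) p).symm z.2))
      (I ×ˢ (extChartAt (𝓡 n) p).target) :=
  contDiff_fst.contMDiff.contMDiffOn.prodMk (contMDiffOn_symm_snd p I)

theorem contDiffOn_coordPsi (N : GaussianSpacetime n S) (p : S) :
    ContDiffOn ℝ ∞ (N.coordPsi p) (N.I ×ˢ (extChartAt (𝓡 n) p).target) :=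
  contMDiffOn_iff_contDiffOn.1 <| N.contMDiffOn_ψ.comp (contMDiffOn_prod_symm p N.I)
    fun _ hz ↦ ⟨hz.1, Set.mem_univ _⟩

/-- This section is the tangent map of the inverse chart applied to a constant vector field. -/
theorem contMDiffOn_chartFrame (p : S) (v : EuclideanSpace ℝ (Fin n)) :
    ContMDiffOn 𝓘(ℝ, EuclideanSpace ℝ (Fin n)) (𝓡 n).tangent ∞
      (fun y ↦ (⟨(extChartAt (𝓡 n) p).symm y, chartFrame p y v⟩ : TangentBundle (𝓡 n) S))
      (extChartAt (𝓡 n) p).target := by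
  have h1 := (contMDiffOn_extChartAt_symm (I := 𝓡 n) (n := ∞) p).contMDiffOn_tangentMapWithin
    (m := ∞) (by simp) (isOpen_extChartAt_target p).uniqueMDiffOn
  have h2 : ContMDiffOn 𝓘(ℝ, EuclideanSpace ℝ (Fin n))
      (𝓘(ℝ, EuclideanSpace ℝ (Fin n))).tangent ∞
      (fun y ↦ (⟨y, v⟩ : TangentBundle 𝓘(ℝ, EuclideanSpace ℝ (Fin n))
        (EuclideanSpace ℝ (Fin n)))) (extChartAt (𝓡 n) p).target := fun y _ ↦
    contMDiffWithinAt_vectorSpace_iff_contDiffWithinAt.2 contDiffWithinAt_const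
  refine (h1.comp h2 fun y hy ↦ hy).congr fun y hy ↦ ?_
  simp only [Function.comp_apply, tangentMapWithin, chartFrame]
  rw [mfderivWithin_of_isOpen (isOpen_extChartAt_target p) hy]
  rfl

/-- In finite dimension it suffices to test on constant vectors, where the value is the smooth
bundle section `σ` paired with two smooth chart frame fields. -/
theorem contDiffOn_coordSigma (N : GaussianSpacetime n S) (p : S) :
    ContDiffOn ℝ ∞ (N.coordSigma p) (N.I ×ˢ (extChartAt (𝓡 n) p).target) := by
  refine contDiffOn_clm_apply.2 fun v ↦ contDiffOn_clm_apply.2 fun w ↦ ?_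
  have hF : ∀ v : EuclideanSpace ℝ (Fin n), ContMDiffOn 𝓘(ℝ, ℝ × EuclideanSpace ℝ (Fin n))
      (𝓡 n).tangent ∞
      (fun z : ℝ × EuclideanSpace ℝ (Fin n) ↦ (⟨(extChartAt (𝓡 n) p).symm z.2,
        chartFrame p z.2 v⟩ : TangentBundle (𝓡 n) S)) (N.I ×ˢ (extChartAt (𝓡 n) p).target) :=
    fun v ↦ (contMDiffOn_chartFrame p v).comp contDiff_snd.contMDiff.contMDiffOn fun _ hz ↦ hz.2
  have hσ := N.contMDiffOn_σ.comp (contMDiffOn_prod_symm p N.I)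
    fun _ hz ↦ ⟨hz.1, Set.mem_univ _⟩
  have h : ContMDiffOn 𝓘(ℝ, ℝ × EuclideanSpace ℝ (Fin n)) ((𝓡 n).prod 𝓘(ℝ, ℝ)) ∞
      (fun z : ℝ × EuclideanSpace ℝ (Fin n) ↦ Bundle.TotalSpace.mk' ℝ
        (E := Bundle.Trivial S ℝ) ((extChartAt (𝓡 n) p).symm z.2)
        (N.σ z.1 ((extChartAt (𝓡 n) p).symm z.2) (chartFrame p z.2 v) (chartFrame p z.2 w)))
      (N.I ×ˢ (extChartAt (𝓡 n) p).target) :=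
    ContMDiffOn.clm_bundle_apply₂ (F₁ := EuclideanSpace ℝ (Fin n))
      (F₂ := EuclideanSpace ℝ (Fin n)) hσ (hF v) (hF w)
  refine contMDiffOn_iff_contDiffOn.1 fun z hz ↦ ?_
  exact ((Bundle.contMDiffWithinAt_totalSpace ..).1 (h z hz)).2

end GaussianSpacetime

/-! ### Gradients and the inverse Gram matrix. -/

section Gradient

variable {E : Type*} [NormedAddCommGroup E] [NormedSpace ℝ E]

/-- Positivity makes `v ↦ B v` injective, hence onto the dual by dimension. This supplies the
gradient. -/
theorem ContinuousLinearMap.exists_dual_vector_of_pos [FiniteDimensional ℝ E]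
    (B : E →L[ℝ] E →L[ℝ] ℝ) (hB : ∀ v, v ≠ 0 → 0 < B v v) (l : E →L[ℝ] ℝ) :
    ∃ ξ, ∀ w, B ξ w = l w := by
  let T : E →ₗ[ℝ] Module.Dual ℝ E :=
    (LinearMap.toContinuousLinearMap : (E →ₗ[ℝ] ℝ) ≃ₗ[ℝ] (E →L[ℝ] ℝ)).symm.toLinearMap ∘ₗ
      B.toLinearMap
  have hinj : Function.Injective T := (injective_iff_map_eq_zero T).2 fun v hv ↦ by
    by_contra hne
    have h1 : B v v = 0 := DFunLike.congr_fun hv v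
    exact (hB v hne).ne' h1
  obtain ⟨ξ, hξ⟩ := (LinearMap.injective_iff_surjective_of_finrank_eq_finrank
    (Subspace.dual_finrank_eq).symm).1 hinj l.toLinearMap
  exact ⟨ξ, fun w ↦ DFunLike.congr_fun hξ w⟩

theorem ContinuousLinearMap.sq_apply_le_of_pos (B : E →L[ℝ] E →L[ℝ] ℝ)
    (hsymm : ∀ v w, B v w = B w v) (hB : ∀ v, v ≠ 0 → 0 < B v v) (v w : E) :
    B v w ^ 2 ≤ B v v * B w w := by
  rcases eq_or_ne v 0 with rfl | hv
  · simp
  have hv := hB v hv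
  have h : 0 ≤ B (B v v • w - B v w • v) (B v v • w - B v w • v) := by
    rcases eq_or_ne (B v v • w - B v w • v) 0 with h | h
    · rw [h]; simp
    · exact (hB _ h).le
  simp only [map_sub, map_smul, sub_apply, smul_apply, smul_eq_mul, hsymm w v] at h
  have h2 : 0 ≤ B v v * (B v v * B w w - B v w ^ 2) := by linarith
  have := nonneg_of_mul_nonneg_right h2 hv
  linarith

theorem gramMatrix_det_ne_zero {n : ℕ}
    (B : EuclideanSpace ℝ (Fin n) →L[ℝ] EuclideanSpace ℝ (Fin n) →L[ℝ] ℝ)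
    (hB : ∀ v, v ≠ 0 → 0 < B v v) :
    (Matrix.of fun i j ↦ B (EuclideanSpace.single i 1) (EuclideanSpace.single j 1)).det ≠ 0 := by
  intro h0
  obtain ⟨v, hv, hv0⟩ := Matrix.exists_vecMul_eq_zero_iff.2 h0
  have hne : WithLp.toLp 2 v ≠ 0 := fun h ↦ hv (by simpa using h)
  have hsum : (WithLp.toLp 2 v : EuclideanSpace ℝ (Fin n))
      = ∑ i, v i • EuclideanSpace.single i (1 : ℝ) := by
    ext j; simp [Pi.single_apply]
  have h1 : ∀ j, B (WithLp.toLp 2 v) (EuclideanSpace.single j 1) = 0 := fun j ↦ by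
    have := congrFun hv0 j
    rw [hsum]
    simpa [Matrix.vecMul, dotProduct] using this
  refine (hB _ hne).ne' ?_
  conv_lhs => enter [2]; rw [hsum]
  rw [map_sum]
  exact Finset.sum_eq_zero fun j _ ↦ by rw [map_smul, h1, smul_zero]

/-- Links the matrix definition of `|Du|²` with the coordinate-free value `Du(ξ)`: the inverse Gram
matrix applied to the components of `l` returns those of `ξ`. -/
theorem sum_inv_gramMatrix {n : ℕ}
    (B : EuclideanSpace ℝ (Fin n) →L[ℝ] EuclideanSpace ℝ (Fin n) →L[ℝ] ℝ)
    (hsymm : ∀ v w, B v w = B w v) (hB : ∀ v, v ≠ 0 → 0 < B v v)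
    (l : EuclideanSpace ℝ (Fin n) →L[ℝ] ℝ) {ξ : EuclideanSpace ℝ (Fin n)}
    (hξ : ∀ w, B ξ w = l w) :
    ∑ i, ∑ j, (Matrix.of fun i j ↦ B (EuclideanSpace.single i 1)
      (EuclideanSpace.single j 1))⁻¹ i j * l (EuclideanSpace.single i 1) *
        l (EuclideanSpace.single j 1) = l ξ := by
  have hdet := gramMatrix_det_ne_zero B hB
  set A : Matrix (Fin n) (Fin n) ℝ :=
    Matrix.of fun i j ↦ B (EuclideanSpace.single i 1) (EuclideanSpace.single j 1) with hA
  have hsum : ξ = ∑ i, ξ i • EuclideanSpace.single i (1 : ℝ) := by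
    ext j; simp [Pi.single_apply]
  have h1 : (fun j ↦ l (EuclideanSpace.single j 1)) = A.mulVec ξ := by
    funext j
    rw [← hξ, hsymm, hsum]
    simp [Matrix.mulVec, dotProduct, hA, Pi.single_apply, mul_comm]
  have h2 : A⁻¹.mulVec (fun j ↦ l (EuclideanSpace.single j 1)) = ξ := by
    rw [h1, Matrix.mulVec_mulVec, Matrix.nonsing_inv_mul _ (isUnit_iff_ne_zero.2 hdet),
      Matrix.one_mulVec]
  have h3 : l ξ = ∑ i, ξ i * l (EuclideanSpace.single i 1) := by
    conv_lhs => rw [hsum]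
    simp
  rw [h3]
  refine Finset.sum_congr rfl fun i _ ↦ ?_
  rw [← congrFun h2 i]
  simp only [Matrix.mulVec, dotProduct, Finset.sum_mul]
  exact Finset.sum_congr rfl fun j _ ↦ by ring

end Gradient

/-! ### `|Du|²` in an arbitrary chart, and its continuity. -/

namespace GaussianSpacetime

variable {n : ℕ} {S : Type*} [TopologicalSpace S]
  [ChartedSpace (EuclideanSpace ℝ (Fin n)) S] [IsManifold (𝓡 n) ∞ S]

theorem mdifferentiableAt_extChartAt_symm {p : S} {y : EuclideanSpace ℝ (Fin n)}
    (hy : y ∈ (extChartAt (𝓡 n) p).target) :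
    MDifferentiableAt 𝓘(ℝ, EuclideanSpace ℝ (Fin n)) (𝓡 n) (extChartAt (𝓡 n) p).symm y :=
  ((contMDiffOn_extChartAt_symm (I := 𝓡 n) (n := ∞) p).contMDiffAt
    ((isOpen_extChartAt_target p).mem_nhds hy)).mdifferentiableAt (by simp)

theorem differential_chartFrame {f : S → ℝ} {p : S} {y : EuclideanSpace ℝ (Fin n)}
    (hy : y ∈ (extChartAt (𝓡 n) p).target)
    (hf : MDifferentiableAt (𝓡 n) 𝓘(ℝ, ℝ) f ((extChartAt (𝓡 n) p).symm y))
    (w : EuclideanSpace ℝ (Fin n)) :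
    differential n f ((extChartAt (𝓡 n) p).symm y) (chartFrame p y w) =
      fderiv ℝ (fun y' ↦ f ((extChartAt (𝓡 n) p).symm y')) y w := by
  have h := mfderiv_comp y hf (mdifferentiableAt_extChartAt_symm hy)
  have h2 : mfderiv 𝓘(ℝ, EuclideanSpace ℝ (Fin n)) 𝓘(ℝ, ℝ)
    (f ∘ (extChartAt (𝓡 n) p).symm) y = fderiv ℝ (f ∘ (extChartAt (𝓡 n) p).symm) y :=
    mfderiv_eq_fderiv
  rw [h2] at h
  exact (DFunLike.congr_fun h w).symm

theorem chartFrame_bijective {p : S} {y : EuclideanSpace ℝ (Fin n)}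
    (hy : y ∈ (extChartAt (𝓡 n) p).target) : Function.Bijective (chartFrame p y) := by
  have h := isInvertible_mfderivWithin_extChartAt_symm (I := 𝓡 n) hy
  rw [modelWithCornersSelf_coe, Set.range_id, mfderivWithin_univ] at h
  obtain ⟨e, he⟩ := h
  have he' : chartFrame p y = e.toContinuousLinearMap := he.symm
  rw [he']
  exact e.bijective

theorem gradNormSq_eq (N : GaussianSpacetime n S) {u : S → ℝ} {x : S} (hx : u x ∈ N.I)
    {ξ : TangentSpace (𝓡 n) x} (hξ : ∀ w, N.σ (u x) x ξ w = differential n u x w) :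
    N.gradNormSq u x = differential n u x ξ :=
  sum_inv_gramMatrix (N.σ (u x) x) (N.σ_symm _ hx x) (N.σ_pos _ hx x) (differential n u x) hξ

theorem coordSigma_symm (N : GaussianSpacetime n S) (p : S)
    {z : ℝ × EuclideanSpace ℝ (Fin n)} (hz : z.1 ∈ N.I) (v w : EuclideanSpace ℝ (Fin n)) :
    N.coordSigma p z v w = N.coordSigma p z w v :=
  N.σ_symm _ hz _ _ _

theorem coordSigma_pos (N : GaussianSpacetime n S) {p : S}
    {z : ℝ × EuclideanSpace ℝ (Fin n)} (hz : z ∈ N.I ×ˢ (extChartAt (𝓡 n) p).target)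
    (v : EuclideanSpace ℝ (Fin n)) (hv : v ≠ 0) : 0 < N.coordSigma p z v v := by
  refine N.σ_pos _ hz.1 _ _ fun h ↦ hv ?_
  exact (chartFrame_bijective hz.2).1 (h.trans (map_zero (chartFrame p z.2)).symm)

/-- Chart independence: `gradNormSq` uses the chart centred at each point, while differentiation
near `p` needs one fixed chart. -/
theorem gradNormSq_eq_coord (N : GaussianSpacetime n S) {u : S → ℝ} {p : S}
    {y : EuclideanSpace ℝ (Fin n)} (hy : y ∈ (extChartAt (𝓡 n) p).target)
    (hu : MDifferentiableAt (𝓡 n) 𝓘(ℝ, ℝ) u ((extChartAt (𝓡 n) p).symm y))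
    (hI : u ((extChartAt (𝓡 n) p).symm y) ∈ N.I) {ξ : EuclideanSpace ℝ (Fin n)}
    (hξ : ∀ w, N.coordSigma p (u ((extChartAt (𝓡 n) p).symm y), y) ξ w =
      fderiv ℝ (fun y' ↦ u ((extChartAt (𝓡 n) p).symm y')) y w) :
    N.gradNormSq u ((extChartAt (𝓡 n) p).symm y) =
      fderiv ℝ (fun y' ↦ u ((extChartAt (𝓡 n) p).symm y')) y ξ := by
  rw [← differential_chartFrame hy hu]
  refine N.gradNormSq_eq hI fun w ↦ ?_
  obtain ⟨w, rfl⟩ := (chartFrame_bijective hy).2 w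
  rw [differential_chartFrame hy hu, ← hξ]
  rfl

/-- Needed for the minimum to exist. In the fixed chart at `p` the function is built from the
continuous `DU` and the inverse of an invertible, continuous Gram matrix. -/
theorem continuousAt_gradNormSq (N : GaussianSpacetime n S) {u : S → ℝ}
    (hu : ContMDiff (𝓡 n) 𝓘(ℝ, ℝ) 2 u) (hI : ∀ x, u x ∈ N.I) (p : S) :
    ContinuousAt (N.gradNormSq u) p := by
  have hopen := isOpen_extChartAt_target (I := 𝓡 n) p
  have hp : extChartAt (𝓡 n) p p ∈ (extChartAt (𝓡 n) p).target := mem_extChartAt_target p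
  have hU : ContDiffOn ℝ 2 (fun y' ↦ u ((extChartAt (𝓡 n) p).symm y'))
      (extChartAt (𝓡 n) p).target :=
    contMDiffOn_iff_contDiffOn.1 (hu.comp_contMDiffOn
      ((contMDiffOn_extChartAt_symm (n := ∞) p).of_le ENat.LEInfty.out))
  set U := fun y' ↦ u ((extChartAt (𝓡 n) p).symm y') with hUdef
  have hUp : ContDiffAt ℝ 2 U (extChartAt (𝓡 n) p p) := hU.contDiffAt (hopen.mem_nhds hp)
  let A : EuclideanSpace ℝ (Fin n) → Matrix (Fin n) (Fin n) ℝ := fun y ↦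
    Matrix.of fun i j ↦ N.coordSigma p (U y, y) (EuclideanSpace.single i 1)
      (EuclideanSpace.single j 1)
  let Q : EuclideanSpace ℝ (Fin n) → ℝ := fun y ↦ ∑ i, ∑ j, (A y)⁻¹ i j *
    fderiv ℝ U y (EuclideanSpace.single i 1) * fderiv ℝ U y (EuclideanSpace.single j 1)
  have hev : N.gradNormSq u =ᶠ[nhds p] Q ∘ extChartAt (𝓡 n) p := by
    filter_upwards [extChartAt_source_mem_nhds (I := 𝓡 n) p] with x hx
    have hy := (extChartAt (𝓡 n) p).map_source hx
    have hpos := fun v hv ↦ N.coordSigma_pos (p := p) (z := (U (extChartAt (𝓡 n) p x),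
      extChartAt (𝓡 n) p x)) ⟨hI _, hy⟩ v hv
    obtain ⟨ξ, hξ⟩ := ContinuousLinearMap.exists_dual_vector_of_pos _ hpos
      (fderiv ℝ U (extChartAt (𝓡 n) p x))
    have h1 := N.gradNormSq_eq_coord hy ((hu _).mdifferentiableAt (by simp)) (hI _) hξ
    rw [(extChartAt (𝓡 n) p).left_inv hx] at h1
    rw [h1]
    exact (sum_inv_gramMatrix _ (N.coordSigma_symm p (z := (_, _)) (hI _)) hpos _ hξ).symm
  have hdU : ContinuousAt (fderiv ℝ U) (extChartAt (𝓡 n) p p) :=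
    (hUp.fderiv_right (m := 1) (by norm_num)).continuousAt
  have hs : ContinuousAt (fun y ↦ N.coordSigma p (U y, y)) (extChartAt (𝓡 n) p p) := by
    have h1 : ContinuousAt (N.coordSigma p) (U (extChartAt (𝓡 n) p p), extChartAt (𝓡 n) p p) :=
      (N.contDiffOn_coordSigma p).continuousOn.continuousAt
        ((N.isOpen_I.prod hopen).mem_nhds ⟨hI _, hp⟩)
    exact ContinuousAt.comp (f := fun y ↦ (U y, y)) h1 (hUp.continuousAt.prodMk continuousAt_id)
  have hA : ContinuousAt A (extChartAt (𝓡 n) p p) :=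
    continuousAt_pi.2 fun i ↦ continuousAt_pi.2 fun j ↦
      (hs.clm_apply continuousAt_const).clm_apply continuousAt_const
  have hdet : (A (extChartAt (𝓡 n) p p)).det ≠ 0 := gramMatrix_det_ne_zero _ fun v hv ↦
    N.coordSigma_pos (p := p) (z := (U (extChartAt (𝓡 n) p p), extChartAt (𝓡 n) p p))
      ⟨hI _, hp⟩ v hv
  have hAinv : ContinuousAt (fun y ↦ (A y)⁻¹) (extChartAt (𝓡 n) p p) := by
    refine ContinuousAt.comp (g := fun M : Matrix (Fin n) (Fin n) ℝ ↦ M⁻¹)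
      (continuousAt_matrix_inv _ ?_) hA
    rw [Ring.inverse_eq_inv']
    exact continuousAt_inv₀ hdet
  have hQ : ContinuousAt Q (extChartAt (𝓡 n) p p) :=
    tendsto_finsetSum _ fun i _ ↦ tendsto_finsetSum _ fun j _ ↦
      ((continuousAt_pi.1 (continuousAt_pi.1 hAinv i) j).mul
        (hdU.clm_apply continuousAt_const)).mul (hdU.clm_apply continuousAt_const)
  exact (ContinuousAt.comp hQ (continuousAt_extChartAt p)).congr hev.symm

end GaussianSpacetime

/-! ### Uniform bounds over compact sets. -/

section QuadraticBound

variable {Z E : Type*} [TopologicalSpace Z] [NormedAddCommGroup E] [NormedSpace ℝ E]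
  [FiniteDimensional ℝ E]

/-- The quotient `f/g` has degree zero in `v`, so it is controlled by its values on the compact set
`K × sphere`. -/
theorem exists_abs_le_mul_of_homogeneous {K : Set Z} (hK : IsCompact K) {f g : Z × E → ℝ}
    (hf : ContinuousOn f (K ×ˢ Set.univ)) (hg : ContinuousOn g (K ×ˢ Set.univ))
    (hfc : ∀ z ∈ K, ∀ (c : ℝ) v, f (z, c • v) = c ^ 2 * f (z, v))
    (hgc : ∀ z ∈ K, ∀ (c : ℝ) v, g (z, c • v) = c ^ 2 * g (z, v))
    (hpos : ∀ z ∈ K, ∀ v, v ≠ 0 → 0 < g (z, v)) :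
    ∃ C, 0 ≤ C ∧ ∀ z ∈ K, ∀ v, |f (z, v)| ≤ C * g (z, v) := by
  have : ProperSpace E := FiniteDimensional.proper ℝ E
  have hsub : K ×ˢ Metric.sphere (0 : E) 1 ⊆ K ×ˢ Set.univ :=
    Set.prod_mono subset_rfl (Set.subset_univ _)
  obtain ⟨C, hC⟩ := (hK.prod (isCompact_sphere (0 : E) 1)).bddAbove_image
    (f := fun x ↦ |f x| / g x)
    ((hf.mono hsub).abs.div (hg.mono hsub) fun x hx ↦
      (hpos x.1 hx.1 x.2 (ne_zero_of_mem_unit_sphere ⟨x.2, hx.2⟩)).ne')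
  refine ⟨max C 0, le_max_right _ _, fun z hz v ↦ ?_⟩
  rcases eq_or_ne v 0 with rfl | hv
  · have h1 := hfc z hz 0 0
    have h2 := hgc z hz 0 0
    simp only [zero_smul, ne_eq, OfNat.ofNat_ne_zero, not_false_eq_true, zero_pow, zero_mul]
      at h1 h2
    simp [h1, h2]
  have hnv : ‖v‖ ≠ 0 := norm_ne_zero_iff.2 hv
  have hmem : ‖v‖⁻¹ • v ∈ Metric.sphere (0 : E) 1 := by simp [norm_smul, hnv]
  have h := hC ⟨(z, ‖v‖⁻¹ • v), ⟨hz, hmem⟩, rfl⟩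
  simp only [hfc z hz, hgc z hz, abs_mul, abs_pow, sq_abs] at h
  rw [mul_div_mul_left _ _ (pow_ne_zero 2 (inv_ne_zero hnv)), div_le_iff₀ (hpos z hz v hv)] at h
  exact h.trans (mul_le_mul_of_nonneg_right (le_max_left _ _) (hpos z hz v hv).le)

set_option maxSynthPendingDepth 6 in
theorem exists_bound_of_isCompact {P : ℝ × E → ℝ} {s : ℝ × E → E →L[ℝ] E →L[ℝ] ℝ}
    {O K : Set (ℝ × E)} (hopen : IsOpen O) (hP : ContDiffOn ℝ ∞ P O) (hs : ContDiffOn ℝ ∞ s O)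
    (hK : IsCompact K) (hKsub : K ⊆ O) (hpos : ∀ z ∈ K, ∀ v, v ≠ 0 → 0 < s z v v) :
    ∃ C, ∀ z ∈ K, |P z| ≤ C ∧ ∀ w, |fderiv ℝ s z (1, 0) w w| ≤ C * s z w w ∧
      (s z w w ≤ 1 → |fderiv ℝ P z (1, w)| ≤ C) := by
  have cs : ContinuousOn s K := hs.continuousOn.mono hKsub
  have cψ : ContinuousOn P K := hP.continuousOn.mono hKsub
  have cds : ContinuousOn (fderiv ℝ s) K :=
    (hs.continuousOn_fderiv_of_isOpen hopen (by simp)).mono hKsub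
  have cdψ : ContinuousOn (fderiv ℝ P) K :=
    (hP.continuousOn_fderiv_of_isOpen hopen (by simp)).mono hKsub
  have hfst : Set.MapsTo Prod.fst (K ×ˢ (Set.univ : Set (E))) K :=
    fun _ h ↦ h.1
  have cg : ContinuousOn (fun x : _ × E ↦ s x.1 x.2 x.2)
      (K ×ˢ Set.univ) :=
    ((cs.comp continuousOn_fst hfst).clm_apply continuousOn_snd).clm_apply continuousOn_snd
  obtain ⟨C₁, hC₁, hσ⟩ := exists_abs_le_mul_of_homogeneous hK
    (f := fun x ↦ fderiv ℝ s x.1 (1, 0) x.2 x.2)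
    (g := fun x ↦ s x.1 x.2 x.2)
    ((((cds.comp continuousOn_fst hfst).clm_apply continuousOn_const).clm_apply
      continuousOn_snd).clm_apply continuousOn_snd) cg
    (fun z _ c v ↦ by simp; ring) (fun z _ c v ↦ by simp; ring) hpos
  -- The spatial derivative of `P` is linear in the vector; its square is quadratic and so
  -- comparable with `s`.
  obtain ⟨C₂, hC₂, hψ⟩ := exists_abs_le_mul_of_homogeneous hK
    (f := fun x ↦ fderiv ℝ P x.1 (0, x.2) ^ 2)
    (g := fun x ↦ s x.1 x.2 x.2)
    (((cdψ.comp continuousOn_fst hfst).clm_apply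
      (continuousOn_const.prodMk continuousOn_snd)).pow 2) cg
    (fun z _ c v ↦ by
      have : ((0 : ℝ), c • v) = c • (0, v) := by simp
      simp only [this, map_smul, smul_eq_mul]
      ring)
    (fun z _ c v ↦ by simp; ring) hpos
  obtain ⟨C₃, hC₃⟩ := hK.exists_bound_of_continuousOn cψ
  obtain ⟨C₄, hC₄⟩ := hK.exists_bound_of_continuousOn
    (f := fun z ↦ fderiv ℝ P z (1, 0)) (cdψ.clm_apply continuousOn_const)
  -- `C₂ + 1` serves because `x² ≤ C₂` implies `|x| ≤ C₂ + 1`.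
  refine ⟨C₁ + (C₂ + 1) + |C₃| + |C₄|, fun z hz ↦ ⟨?_, fun w ↦ ⟨?_, fun hw ↦ ?_⟩⟩⟩
  · have := hC₃ z hz
    rw [Real.norm_eq_abs] at this
    linarith [le_abs_self C₃, abs_nonneg C₄]
  · refine (hσ z hz w).trans (mul_le_mul_of_nonneg_right ?_ ?_)
    · linarith [abs_nonneg C₃, abs_nonneg C₄]
    · rcases eq_or_ne w 0 with rfl | hw
      · simp
      · exact (hpos z hz w hw).le
  · have h1 := hψ z hz w
    have h2 := hC₄ z hz
    rw [Real.norm_eq_abs] at h2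
    have h3 : ((1 : ℝ), w) = (1, 0) + (0, w) := by simp
    have h4 : |fderiv ℝ P z (0, w)| ≤ C₂ + 1 := by
      have h5 : |fderiv ℝ P z (0, w)| ^ 2 ≤ C₂ := by
        rw [sq_abs]
        exact ((le_abs_self _).trans h1).trans (mul_le_of_le_one_right hC₂ hw)
      nlinarith
    rw [h3, map_add]
    refine (abs_add_le _ _).trans ?_
    linarith [abs_nonneg C₃, le_abs_self C₄]

end QuadraticBound

/-! ### A uniform constant over `[a, b] × S`. -/

namespace GaussianSpacetime

variable {n : ℕ} {S : Type*} [TopologicalSpace S]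
  [ChartedSpace (EuclideanSpace ℝ (Fin n)) S] [IsManifold (𝓡 n) ∞ S]

/-- The constant `C` bounds `ψ` and the first derivatives of `ψ` and `σ` which enter the
gradient estimate at the point `(t, x)`. -/
def BoundedBy (N : GaussianSpacetime n S) (C t : ℝ) (x : S) : Prop :=
  |N.ψ t x| ≤ C ∧ ∀ v : TangentSpace (𝓡 n) x,
    |deriv (fun t' ↦ N.σ t' x v v) t| ≤ C * N.σ t x v v ∧
    (N.σ t x v v ≤ 1 → |deriv (fun t' ↦ N.ψ t' x) t + differential n (N.ψ t) x v| ≤ C)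

theorem BoundedBy.mono {N : GaussianSpacetime n S} {C C' t : ℝ} {x : S} (ht : t ∈ N.I)
    (h : N.BoundedBy C t x) (hC : C ≤ C') : N.BoundedBy C' t x := by
  refine ⟨h.1.trans hC, fun v ↦ ⟨(h.2 v).1.trans (mul_le_mul_of_nonneg_right hC ?_),
    fun hv ↦ ((h.2 v).2 hv).trans hC⟩⟩
  rcases eq_or_ne v 0 with rfl | hv
  · simp
  · exact (N.σ_pos t ht x v hv).le

theorem mdifferentiableAt_ψ (N : GaussianSpacetime n S) {t : ℝ} (ht : t ∈ N.I) (x : S) :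
    MDifferentiableAt (𝓡 n) 𝓘(ℝ, ℝ) (N.ψ t) x := by
  have h1 : ContMDiffAt (𝓘(ℝ, ℝ).prod (𝓡 n)) 𝓘(ℝ, ℝ) ∞ (fun z : ℝ × S ↦ N.ψ z.1 z.2) (t, x) :=
    N.contMDiffOn_ψ.contMDiffAt ((N.isOpen_I.prod isOpen_univ).mem_nhds ⟨ht, Set.mem_univ _⟩)
  have h2 : ContMDiffAt (𝓡 n) (𝓘(ℝ, ℝ).prod (𝓡 n)) ∞ (fun x' : S ↦ (t, x')) x :=
    contMDiffAt_const.prodMk contMDiffAt_id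
  exact (h1.comp x h2).mdifferentiableAt (by simp)

variable {N : GaussianSpacetime n S} {p : S} {z : ℝ × EuclideanSpace ℝ (Fin n)}

theorem mem_nhds_domain (hz : z ∈ N.I ×ˢ (extChartAt (𝓡 n) p).target) :
    N.I ×ˢ (extChartAt (𝓡 n) p).target ∈ nhds z :=
  (N.isOpen_I.prod (isOpen_extChartAt_target p)).mem_nhds hz

theorem differentiableAt_coordSigma (hz : z ∈ N.I ×ˢ (extChartAt (𝓡 n) p).target) :
    DifferentiableAt ℝ (N.coordSigma p) z :=
  ((N.contDiffOn_coordSigma p).contDiffAt (mem_nhds_domain hz)).differentiableAt (by simp)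

theorem differentiableAt_coordPsi (hz : z ∈ N.I ×ˢ (extChartAt (𝓡 n) p).target) :
    DifferentiableAt ℝ (N.coordPsi p) z :=
  ((N.contDiffOn_coordPsi p).contDiffAt (mem_nhds_domain hz)).differentiableAt (by simp)

theorem deriv_σ_chartFrame (hz : z ∈ N.I ×ˢ (extChartAt (𝓡 n) p).target)
    (w : EuclideanSpace ℝ (Fin n)) :
    deriv (fun t ↦ N.σ t ((extChartAt (𝓡 n) p).symm z.2) (chartFrame p z.2 w)
      (chartFrame p z.2 w)) z.1 = fderiv ℝ (N.coordSigma p) z (1, 0) w w := by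
  have h1 := ((differentiableAt_coordSigma hz).hasFDerivAt.clm_apply
    (hasFDerivAt_const w z)).clm_apply (hasFDerivAt_const w z)
  have h2 : HasDerivAt (fun t : ℝ ↦ (t, z.2)) (1, 0) z.1 :=
    (hasDerivAt_id z.1).prodMk (hasDerivAt_const z.1 z.2)
  have h3 : HasDerivAt (fun t ↦ N.coordSigma p (t, z.2) w w) _ z.1 :=
    HasFDerivAt.comp_hasDerivAt (f := fun t : ℝ ↦ (t, z.2))
      (l := fun y ↦ N.coordSigma p y w w) z.1 h1 h2
  exact h3.deriv.trans (by simp)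

theorem deriv_ψ_chartFrame (hz : z ∈ N.I ×ˢ (extChartAt (𝓡 n) p).target)
    (w : EuclideanSpace ℝ (Fin n)) :
    deriv (fun t ↦ N.ψ t ((extChartAt (𝓡 n) p).symm z.2)) z.1
      + differential n (N.ψ z.1) ((extChartAt (𝓡 n) p).symm z.2) (chartFrame p z.2 w)
      = fderiv ℝ (N.coordPsi p) z (1, w) := by
  have h1 := (differentiableAt_coordPsi hz).hasFDerivAt
  have h2 : HasDerivAt (fun t : ℝ ↦ (t, z.2)) (1, 0) z.1 :=
    (hasDerivAt_id z.1).prodMk (hasDerivAt_const z.1 z.2)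
  have h3 : HasDerivAt (fun t ↦ N.ψ t ((extChartAt (𝓡 n) p).symm z.2))
      (fderiv ℝ (N.coordPsi p) z (1, 0)) z.1 :=
    HasFDerivAt.comp_hasDerivAt (f := fun t : ℝ ↦ (t, z.2)) (l := N.coordPsi p) z.1 h1 h2
  have h4 : HasFDerivAt (fun y ↦ N.ψ z.1 ((extChartAt (𝓡 n) p).symm y))
      ((fderiv ℝ (N.coordPsi p) z).comp (ContinuousLinearMap.inr ℝ ℝ _)) z.2 :=
    HasFDerivAt.comp (g := N.coordPsi p) (f := fun y ↦ (z.1, y)) z.2 h1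
      (hasFDerivAt_prodMk_right z.1 z.2)
  rw [h3.deriv, differential_chartFrame hz.2 (N.mdifferentiableAt_ψ hz.1 _), h4.fderiv]
  have : ((1 : ℝ), w) = (1, 0) + (0, w) := by simp
  rw [this, map_add]
  rfl

theorem boundedBy_iff (hz : z ∈ N.I ×ˢ (extChartAt (𝓡 n) p).target) (C : ℝ) :
    N.BoundedBy C z.1 ((extChartAt (𝓡 n) p).symm z.2) ↔
      |N.coordPsi p z| ≤ C ∧ ∀ w : EuclideanSpace ℝ (Fin n),
        |fderiv ℝ (N.coordSigma p) z (1, 0) w w| ≤ C * N.coordSigma p z w w ∧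
        (N.coordSigma p z w w ≤ 1 → |fderiv ℝ (N.coordPsi p) z (1, w)| ≤ C) := by
  refine and_congr Iff.rfl ((chartFrame_bijective hz.2).2.forall.trans (forall_congr' fun w ↦ ?_))
  rw [deriv_σ_chartFrame hz, deriv_ψ_chartFrame hz]
  rfl

theorem exists_boundedBy_of_isCompact {K : Set (ℝ × EuclideanSpace ℝ (Fin n))}
    (hK : IsCompact K) (hKsub : K ⊆ N.I ×ˢ (extChartAt (𝓡 n) p).target) :
    ∃ C, ∀ z ∈ K, N.BoundedBy C z.1 ((extChartAt (𝓡 n) p).symm z.2) := by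
  obtain ⟨C, hC⟩ := exists_bound_of_isCompact
    (N.isOpen_I.prod (isOpen_extChartAt_target (I := 𝓡 n) p)) (N.contDiffOn_coordPsi p)
    (N.contDiffOn_coordSigma p) hK hKsub fun z hz v hv ↦ N.coordSigma_pos (hKsub hz) v hv
  exact ⟨C, fun z hz ↦ (boundedBy_iff (hKsub hz) _).2 (hC z hz)⟩

/-- `BoundedBy` does not refer to a chosen chart at `p`, so the constants found on small closed
coordinate balls times `[a, b]` can be patched by compactness of `S`. -/
theorem exists_boundedBy [CompactSpace S] (N : GaussianSpacetime n S) {a b : ℝ}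
    (hab : Set.Icc a b ⊆ N.I) : ∃ C, ∀ t ∈ Set.Icc a b, ∀ x, N.BoundedBy C t x := by
  suffices h : ∃ C, ∀ x ∈ (Set.univ : Set S), ∀ t ∈ Set.Icc a b, N.BoundedBy C t x by
    obtain ⟨C, hC⟩ := h
    exact ⟨C, fun t ht x ↦ hC x (Set.mem_univ x) t ht⟩
  refine isCompact_univ.induction_on
    (p := fun s ↦ ∃ C, ∀ x ∈ s, ∀ t ∈ Set.Icc a b, N.BoundedBy C t x) ⟨0, by simp⟩
    (fun s t hst ⟨C, hC⟩ ↦ ⟨C, fun x hx ↦ hC x (hst hx)⟩)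
    (fun s s' ⟨C, hC⟩ ⟨C', hC'⟩ ↦ ⟨max C C', fun x hx t ht ↦ ?_⟩) fun p _ ↦ ?_
  · rcases hx with hx | hx
    · exact (hC x hx t ht).mono (hab ht) (le_max_left _ _)
    · exact (hC' x hx t ht).mono (hab ht) (le_max_right _ _)
  · obtain ⟨r, hr, hsub⟩ := Metric.nhds_basis_closedBall.mem_iff.1
      (extChartAt_target_mem_nhds (I := 𝓡 n) p)
    obtain ⟨C, hC⟩ := exists_boundedBy_of_isCompact (N := N) (p := p)
      (isCompact_Icc.prod (isCompact_closedBall (extChartAt (𝓡 n) p p) r))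
      (Set.prod_mono hab hsub)
    refine ⟨_, mem_nhdsWithin_of_mem_nhds (Filter.inter_mem
      (extChartAt_source_mem_nhds (I := 𝓡 n) p)
      ((continuousAt_extChartAt (I := 𝓡 n) p).preimage_mem_nhds
        (Metric.closedBall_mem_nhds _ hr))), C, fun x hx t ht ↦ ?_⟩
    have := hC (t, extChartAt (𝓡 n) p x) ⟨ht, hx.2⟩
    rwa [(extChartAt (𝓡 n) p).left_inv hx.1] at this

end GaussianSpacetime

/-! ### The gradient estimate. -/

namespace GaussianSpacetime

variable {n : ℕ} {S : Type*} [TopologicalSpace S]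
  [ChartedSpace (EuclideanSpace ℝ (Fin n)) S] [IsManifold (𝓡 n) ∞ S]

/-- A function on `S` in the local coordinates given by the chart at `p`. -/
noncomputable def coordFun (n : ℕ) {S : Type*} [TopologicalSpace S]
    [ChartedSpace (EuclideanSpace ℝ (Fin n)) S] (u : S → ℝ) (p : S)
    (y : EuclideanSpace ℝ (Fin n)) : ℝ :=
  u ((extChartAt (𝓡 n) p).symm y)

theorem coordGraph_eq {n : ℕ} {S : Type*} [TopologicalSpace S]
    [ChartedSpace (EuclideanSpace ℝ (Fin n)) S] {u : S → ℝ} {p : S} :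
    coordGraph n u p = fun y ↦ (coordFun n u p y, y) := rfl

theorem coordFun_self {n : ℕ} {S : Type*} [TopologicalSpace S]
    [ChartedSpace (EuclideanSpace ℝ (Fin n)) S] {u : S → ℝ} {p : S} :
    coordFun n u p (extChartAt (𝓡 n) p p) = u p :=
  congrArg u (extChartAt_to_inv p)

variable {N : GaussianSpacetime n S} {u : S → ℝ} {p : S}

theorem contDiffAt_coordFun (hu : ContMDiff (𝓡 n) 𝓘(ℝ, ℝ) 2 u) :
    ContDiffAt ℝ 2 (coordFun n u p) (extChartAt (𝓡 n) p p) := by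
  have hU : ContDiffOn ℝ 2 (coordFun n u p) (extChartAt (𝓡 n) p).target :=
    contMDiffOn_iff_contDiffOn.1 (hu.comp_contMDiffOn
      ((contMDiffOn_extChartAt_symm (n := ∞) p).of_le ENat.LEInfty.out))
  exact hU.contDiffAt (extChartAt_target_mem_nhds p)

theorem mem_domain (hI : ∀ x, u x ∈ N.I) {y : EuclideanSpace ℝ (Fin n)}
    (hy : y ∈ (extChartAt (𝓡 n) p).target) :
    (coordFun n u p y, y) ∈ N.I ×ˢ (extChartAt (𝓡 n) p).target := ⟨hI _, hy⟩

theorem exists_gradient (hu : ContMDiff (𝓡 n) 𝓘(ℝ, ℝ) 2 u) (hI : ∀ x, u x ∈ N.I)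
    {y : EuclideanSpace ℝ (Fin n)} (hy : y ∈ (extChartAt (𝓡 n) p).target) :
    ∃ ξ, (∀ w, N.coordSigma p (coordFun n u p y, y) ξ w = fderiv ℝ (coordFun n u p) y w) ∧
      N.gradNormSq u ((extChartAt (𝓡 n) p).symm y) = fderiv ℝ (coordFun n u p) y ξ := by
  obtain ⟨ξ, hξ⟩ := ContinuousLinearMap.exists_dual_vector_of_pos _
    (N.coordSigma_pos (mem_domain hI hy)) (fderiv ℝ (coordFun n u p) y)
  exact ⟨ξ, hξ, N.gradNormSq_eq_coord hy ((hu _).mdifferentiableAt (by simp)) (hI _) hξ⟩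

/-- Cauchy–Schwarz against the gradient at `y`; it allows a frozen vector to replace the varying
gradient. -/
theorem div_le_gradNormSq (hu : ContMDiff (𝓡 n) 𝓘(ℝ, ℝ) 2 u) (hI : ∀ x, u x ∈ N.I)
    {y : EuclideanSpace ℝ (Fin n)} (hy : y ∈ (extChartAt (𝓡 n) p).target)
    {v : EuclideanSpace ℝ (Fin n)} (hv : v ≠ 0) :
    fderiv ℝ (coordFun n u p) y v ^ 2 / N.coordSigma p (coordFun n u p y, y) v v ≤
      N.gradNormSq u ((extChartAt (𝓡 n) p).symm y) := by
  obtain ⟨ξ, hξ, hq⟩ := exists_gradient hu hI hy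
  have hpos := N.coordSigma_pos (mem_domain hI hy)
  rw [hq, div_le_iff₀ (hpos v hv), ← hξ, ← hξ]
  exact ContinuousLinearMap.sq_apply_le_of_pos _ (N.coordSigma_symm p (hI _)) hpos ξ v

theorem graphMetric_pos (hu : ContMDiff (𝓡 n) 𝓘(ℝ, ℝ) 2 u) (hspace : N.IsSpacelikeGraph u)
    (p : S) (v : EuclideanSpace ℝ (Fin n)) (hv : v ≠ 0) :
    0 < graphMetric (N.coordPsi p) (N.coordSigma p)
      (coordFun n u p (extChartAt (𝓡 n) p p), extChartAt (𝓡 n) p p)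
      (fderiv ℝ (coordFun n u p) (extChartAt (𝓡 n) p p)) v v := by
  rw [← inducedMetric_graph ((contDiffAt_coordFun hu).differentiableAt (by simp))]
  exact hspace p v hv

/-- Spacelikeness tested on the gradient reads `e^{2ψ} q(1 - q) > 0`. -/
theorem gradNormSq_lt_one (hu : ContMDiff (𝓡 n) 𝓘(ℝ, ℝ) 2 u) (hI : ∀ x, u x ∈ N.I)
    (hspace : N.IsSpacelikeGraph u) (p : S) : N.gradNormSq u p < 1 := by
  obtain ⟨ξ, hξ, hq⟩ := exists_gradient hu hI (mem_extChartAt_target (I := 𝓡 n) p)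
  rw [extChartAt_to_inv] at hq
  rw [hq]
  rcases eq_or_ne ξ 0 with rfl | hne
  · simp
  have h1 := graphMetric_pos hu hspace p ξ hne
  have h2 := N.coordSigma_pos (mem_domain hI (mem_extChartAt_target (I := 𝓡 n) p)) ξ hne
  simp only [graphMetric, LinearMap.mk₂_apply, conformalMetric, hξ] at h1 h2
  have h3 := pos_of_mul_pos_right h1 (Real.exp_pos _).le
  nlinarith

/-- Exhibits `graphNormal` as the past directed unit normal, so that the curvature hypothesis
applies to eigenvalues of the explicit form `graphForm`. -/
theorem isPrincipalCurvature_of_graphForm (hu : ContMDiff (𝓡 n) 𝓘(ℝ, ℝ) 2 u)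
    (hI : ∀ x, u x ∈ N.I) (hspace : N.IsSpacelikeGraph u) {ξ : EuclideanSpace ℝ (Fin n)}
    (hξ : ∀ w, N.coordSigma p (coordFun n u p (extChartAt (𝓡 n) p p), extChartAt (𝓡 n) p p) ξ w =
      fderiv ℝ (coordFun n u p) (extChartAt (𝓡 n) p p) w)
    (hq : N.gradNormSq u p = fderiv ℝ (coordFun n u p) (extChartAt (𝓡 n) p p) ξ)
    {κ : ℝ} {v : EuclideanSpace ℝ (Fin n)} (hv : v ≠ 0)
    (hκ : ∀ w, graphForm (N.coordPsi p) (N.coordSigma p)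
        (coordFun n u p (extChartAt (𝓡 n) p p), extChartAt (𝓡 n) p p)
        (fderiv ℝ (coordFun n u p) (extChartAt (𝓡 n) p p))
        (fderiv ℝ (fderiv ℝ (coordFun n u p)) (extChartAt (𝓡 n) p p))
        (graphNormal (N.coordPsi p)
          (coordFun n u p (extChartAt (𝓡 n) p p), extChartAt (𝓡 n) p p) ξ
          (fderiv ℝ (coordFun n u p) (extChartAt (𝓡 n) p p) ξ)) v w =
      κ * graphMetric (N.coordPsi p) (N.coordSigma p)
        (coordFun n u p (extChartAt (𝓡 n) p p), extChartAt (𝓡 n) p p)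
        (fderiv ℝ (coordFun n u p) (extChartAt (𝓡 n) p p)) v w) :
    N.IsPrincipalCurvature u p κ := by
  have hU := contDiffAt_coordFun (p := p) hu
  have hU1 := hU.differentiableAt (by simp)
  have hz := mem_domain (p := p) hI (mem_extChartAt_target (I := 𝓡 n) p)
  have hlt := gradNormSq_lt_one hu hI hspace p
  rw [hq] at hlt
  refine ⟨graphNormal (N.coordPsi p) (coordFun n u p (extChartAt (𝓡 n) p p),
    extChartAt (𝓡 n) p p) ξ (fderiv ℝ (coordFun n u p) (extChartAt (𝓡 n) p p) ξ),
    ⟨fun w ↦ ?_, conformalMetric_graphNormal_self (P := N.coordPsi p) hξ hlt, ?_⟩, v, hv, fun w ↦ ?_⟩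
  · rw [coordGraph_eq, fderiv_graph hU1]
    exact conformalMetric_graphNormal (P := N.coordPsi p) hξ w
  · have : 0 < Real.exp (-N.coordPsi p (coordFun n u p (extChartAt (𝓡 n) p p),
      extChartAt (𝓡 n) p p)) / √(1 - fderiv ℝ (coordFun n u p) (extChartAt (𝓡 n) p p) ξ) :=
      div_pos (Real.exp_pos _) (Real.sqrt_pos.2 (by linarith))
    simpa [graphNormal] using this
  · rw [coordGraph_eq, coordMetric_eq, inducedMetric_graph hU1,
      secondFundamentalForm_graph (differentiableAt_coordPsi hz) (differentiableAt_coordSigma hz)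
        hU]
    exact hκ w

/-- At a minimum point of `(1 - |Du|²) e^{-2λu}` the gradient is bounded. -/
theorem one_le_mul_of_isMin {C κ₁ ε : ℝ} (hε : ε * ε = 1) (hu : ContMDiff (𝓡 n) 𝓘(ℝ, ℝ) 2 u)
    (hI : ∀ x, u x ∈ N.I) (hspace : N.IsSpacelikeGraph u) (hC : N.BoundedBy C (u p) p)
    (hκ : ∀ κ, N.IsPrincipalCurvature u p κ → ε * κ ≤ κ₁)
    (hmin : ∀ x, (1 - N.gradNormSq u p) * Real.exp (-2 * (ε * (2 * C + 1)) * u p) ≤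
      (1 - N.gradNormSq u x) * Real.exp (-2 * (ε * (2 * C + 1)) * u x)) :
    1 ≤ max 1 (κ₁ * Real.exp C) ^ 2 * (1 - N.gradNormSq u p) := by
  have hy := mem_extChartAt_target (I := 𝓡 n) p
  have hlt := gradNormSq_lt_one hu hI hspace p
  obtain ⟨ξ, hξ, hq⟩ := exists_gradient hu hI hy
  rw [extChartAt_to_inv] at hq
  have hmax : 1 ≤ max 1 (κ₁ * Real.exp C) ^ 2 := one_le_pow₀ (le_max_left _ _)
  -- At a critical point of `u` the factor `1 - |Du|²` is `1`; the `max` with `1` covers this case.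
  rcases eq_or_ne ξ 0 with rfl | hne
  · rw [hq, map_zero, sub_zero, mul_one]
    exact hmax
  have hz := mem_domain (p := p) hI hy
  have hU := contDiffAt_coordFun (p := p) hu
  have hs := differentiableAt_coordSigma hz
  have hpos := N.coordSigma_pos hz ξ hne
  have hgpos := graphMetric_pos hu hspace p
  have hself := coordFun_self (n := n) (u := u) (p := p)
  have hcurv := fun κ v hv h ↦ hκ κ
    (isPrincipalCurvature_of_graphForm hu hI hspace hξ hq (κ := κ) (v := v) hv h)
  have hbound : N.BoundedBy C (coordFun n u p (extChartAt (𝓡 n) p p))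
      ((extChartAt (𝓡 n) p).symm (extChartAt (𝓡 n) p p)) := by
    rwa [hself, extChartAt_to_inv]
  replace hbound := (boundedBy_iff hz C).1 hbound
  -- Freezing `ξ` can only increase the function near `p`, and it leaves the value at `p` unchanged.
  have hloc : IsLocalMin (fun y ↦ (1 - fderiv ℝ (coordFun n u p) y ξ ^ 2 /
      N.coordSigma p (coordFun n u p y, y) ξ ξ) *
      Real.exp (-2 * (ε * (2 * C + 1)) * coordFun n u p y)) (extChartAt (𝓡 n) p p) := by
    filter_upwards [extChartAt_target_mem_nhds (I := 𝓡 n) p] with y hyt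
    have h1 : fderiv ℝ (coordFun n u p) (extChartAt (𝓡 n) p p) ξ ^ 2 /
      N.coordSigma p (coordFun n u p (extChartAt (𝓡 n) p p), extChartAt (𝓡 n) p p) ξ ξ
        = N.gradNormSq u p := by
      rw [hq, ← hξ, sq, mul_div_assoc, div_self hpos.ne', mul_one]
    rw [h1, hself]
    refine (hmin ((extChartAt (𝓡 n) p).symm y)).trans
      (mul_le_mul_of_nonneg_right ?_ (Real.exp_pos _).le)
    linarith [div_le_gradNormSq hu hI hyt hne]
  rw [hξ] at hpos
  have hcrit := fderiv_fderiv_gradient_of_isLocalMin hU hs hξ hpos hloc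
  have hform := graphForm_gradient (P := N.coordPsi p) (N.coordSigma_symm p hz.1) hξ hcrit
  have hsymm : ∀ᶠ z in nhds (coordFun n u p (extChartAt (𝓡 n) p p), extChartAt (𝓡 n) p p),
      ∀ v w, N.coordSigma p z v w = N.coordSigma p z w v := by
    filter_upwards [mem_nhds_domain hz] with z hz using N.coordSigma_symm p hz.1
  rw [hq] at hlt ⊢
  set y₀ := extChartAt (𝓡 n) p p
  set z₀ := (coordFun n u p y₀, y₀) with hz₀
  set l := fderiv ℝ (coordFun n u p) y₀ with hl
  set h := graphForm (N.coordPsi p) (N.coordSigma p) z₀ l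
    (fderiv ℝ (fderiv ℝ (coordFun n u p)) y₀) (graphNormal (N.coordPsi p) z₀ ξ (l ξ)) with hh
  set g := graphMetric (N.coordPsi p) (N.coordSigma p) z₀ l with hg
  have hhsymm : ∀ v w, h v w = h w v := graphForm_symm hs hsymm l
    (fun v w ↦ hU.isSymmSndFDerivAt (by simp) v w) _
  have hgsymm : ∀ v w, g v w = g w v := fun v w ↦ by
    simp only [hg, graphMetric, LinearMap.mk₂_apply, conformalMetric,
      N.coordSigma_symm p hz.1 v w]
    ring
  -- Since `ε² = 1`, an eigenvalue `κ` of `ε h` corresponds to the principal curvature `ε κ`, so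
  -- both one-sided conditions become an upper bound.
  have hle := LinearMap.apply_self_le_of_eigenvalues_le g (ε • h) hgsymm
    (fun v w ↦ by simp [hhsymm v w]) hgpos κ₁ (fun κ v hv hvw ↦ by
      have h1 := hcurv (ε * κ) v hv fun w ↦ by
        have h2 := hvw w
        simp only [LinearMap.smul_apply, smul_eq_mul] at h2
        calc h v w = ε * ε * h v w := by rw [hε, one_mul]
          _ = ε * κ * g v w := by rw [mul_assoc, h2, mul_assoc]
      rwa [← mul_assoc, hε, one_mul] at h1) ξ
  simp only [LinearMap.smul_apply, smul_eq_mul, hform] at hle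
  have hgξ : g ξ ξ = Real.exp (2 * N.coordPsi p z₀) * (1 - l ξ) * l ξ := by
    simp only [hg, graphMetric, LinearMap.mk₂_apply, conformalMetric, hξ]
    ring
  rw [hgξ] at hle
  obtain ⟨hψ, hd⟩ := hbound
  obtain ⟨hd1, hd2⟩ := hd ξ
  rw [hξ] at hd1 hd2
  replace hd2 := hd2 hlt.le
  set k := Real.exp (-N.coordPsi p z₀) / √(1 - l ξ) with hk
  set X := fderiv ℝ (N.coordSigma p) z₀ (1, 0) ξ ξ
  set Y := fderiv ℝ (N.coordPsi p) z₀ (1, ξ)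
  have hC0 : 0 ≤ C := (abs_nonneg _).trans hψ
  have hsq : 0 < √(1 - l ξ) := Real.sqrt_pos.2 (by linarith)
  have hk0 : 0 < k := div_pos (Real.exp_pos _) hsq
  have hεabs : |ε| = 1 := by
    rcases mul_self_eq_one_iff.1 hε with rfl | rfl <;> simp
  -- The error terms cost at most `2C |Du|²`; the extra `1` in `2C + 1` is what survives to give `k
  -- ≤ κ₁`.
  have hXY : ε * (X / 2 + Y * l ξ) ≤ 2 * C * l ξ := by
    refine (le_abs_self _).trans ?_
    rw [abs_mul, hεabs, one_mul]
    refine (abs_add_le _ _).trans ?_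
    rw [abs_div, abs_mul, abs_of_pos hpos, abs_two]
    have := mul_le_mul_of_nonneg_right hd2 hpos.le
    nlinarith [mul_nonneg hC0 hpos.le]
  have hkκ : k ≤ κ₁ := by
    have hE : 0 < Real.exp (2 * N.coordPsi p z₀) * (1 - l ξ) :=
      mul_pos (Real.exp_pos _) (by linarith)
    have h1 : ε * (-k * Real.exp (2 * N.coordPsi p z₀) * (1 - l ξ) *
        (X / 2 - ε * (2 * C + 1) * l ξ + Y * l ξ)) =
        (Real.exp (2 * N.coordPsi p z₀) * (1 - l ξ)) *
          (k * ((2 * C + 1) * l ξ * (ε * ε) - ε * (X / 2 + Y * l ξ))) := by ring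
    have h2 : κ₁ * (Real.exp (2 * N.coordPsi p z₀) * (1 - l ξ) * l ξ) =
      (Real.exp (2 * N.coordPsi p z₀) * (1 - l ξ)) * (κ₁ * l ξ) := by ring
    rw [h1, h2, hε] at hle
    have h3 := le_of_mul_le_mul_left hle hE
    have h4 : k * l ξ ≤ k * ((2 * C + 1) * l ξ * 1 - ε * (X / 2 + Y * l ξ)) :=
      mul_le_mul_of_nonneg_left (by linarith) hk0.le
    exact le_of_mul_le_mul_right (h4.trans h3) hpos
  have h5 : 1 ≤ κ₁ * Real.exp C * √(1 - l ξ) := by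
    have h6 : Real.exp (-C) ≤ κ₁ * √(1 - l ξ) :=
      (Real.exp_le_exp.2 (neg_le_neg ((le_abs_self _).trans hψ))).trans
        ((div_le_iff₀ hsq).1 hkκ)
    calc (1 : ℝ) = Real.exp (-C) * Real.exp C := by rw [← Real.exp_add]; simp
      _ ≤ κ₁ * √(1 - l ξ) * Real.exp C := mul_le_mul_of_nonneg_right h6 (Real.exp_pos _).le
      _ = _ := by ring
  have h7 : 1 ≤ max 1 (κ₁ * Real.exp C) * √(1 - l ξ) :=
    h5.trans (mul_le_mul_of_nonneg_right (le_max_right _ _) hsq.le)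
  calc (1 : ℝ) ≤ (max 1 (κ₁ * Real.exp C) * √(1 - l ξ)) ^ 2 := one_le_pow₀ h7
    _ = _ := by rw [mul_pow, Real.sq_sqrt (by linarith)]

/-- Minimality at `p` bounds `1 - |Du|²` at `x` below by its value at `p` times `e^{2λ(u(x) -
u(p))}`, and `|u(x) - u(p)| ≤ b - a`. -/
theorem tiltFactor_le [CompactSpace S] {a b C κ₁ ε : ℝ} (hε : ε * ε = 1)
    (hab : Set.Icc a b ⊆ N.I) (hC : ∀ t ∈ Set.Icc a b, ∀ x, N.BoundedBy C t x)
    (hu : ContMDiff (𝓡 n) 𝓘(ℝ, ℝ) 2 u) (hab' : ∀ x, u x ∈ Set.Icc a b)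
    (hspace : N.IsSpacelikeGraph u)
    (hκ : ∀ p κ, N.IsPrincipalCurvature u p κ → ε * κ ≤ κ₁) (x : S) :
    N.tiltFactor u x ≤ 1 / √((max 1 (κ₁ * Real.exp C) ^ 2)⁻¹ *
      Real.exp (-(2 * (2 * C + 1) * (b - a)))) := by
  have hI : ∀ x, u x ∈ N.I := fun x ↦ hab (hab' x)
  have hcont : Continuous fun x ↦ (1 - N.gradNormSq u x) *
      Real.exp (-2 * (ε * (2 * C + 1)) * u x) :=
    (continuous_const.sub (continuous_iff_continuousAt.2 (N.continuousAt_gradNormSq hu hI))).mul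
      (Real.continuous_exp.comp (continuous_const.mul hu.continuous))
  obtain ⟨p, -, hp⟩ := isCompact_univ.exists_isMinOn ⟨x, Set.mem_univ x⟩ hcont.continuousOn
  have hmin := fun x ↦ hp (Set.mem_univ x)
  have h1 := one_le_mul_of_isMin hε hu hI hspace (hC _ (hab' p) p) (hκ p) hmin
  have hR : 0 < max 1 (κ₁ * Real.exp C) ^ 2 :=
    pow_pos (lt_of_lt_of_le one_pos (le_max_left _ _)) 2
  have h2 : (max 1 (κ₁ * Real.exp C) ^ 2)⁻¹ ≤ 1 - N.gradNormSq u p := by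
    rwa [inv_le_iff_one_le_mul₀' hR]
  have h3 : (1 - N.gradNormSq u p) * Real.exp (2 * (ε * (2 * C + 1)) * (u x - u p)) ≤
      1 - N.gradNormSq u x := by
    have h4 : (1 - N.gradNormSq u p) * Real.exp (-2 * (ε * (2 * C + 1)) * u p) ≤
      (1 - N.gradNormSq u x) * Real.exp (-2 * (ε * (2 * C + 1)) * u x) := hmin x
    have h5 := mul_le_mul_of_nonneg_right h4 (Real.exp_pos (2 * (ε * (2 * C + 1)) * u x)).le
    rw [mul_assoc (1 - _), mul_assoc (1 - _), ← Real.exp_add, ← Real.exp_add] at h5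
    convert! h5 using 1
    · congr 2; ring
    · rw [show -2 * (ε * (2 * C + 1)) * u x + 2 * (ε * (2 * C + 1)) * u x = 0 by ring,
        Real.exp_zero, mul_one]
  have hC0 : 0 ≤ C := (abs_nonneg _).trans (hC _ (hab' p) p).1
  have h6 : -(2 * (2 * C + 1) * (b - a)) ≤ 2 * (ε * (2 * C + 1)) * (u x - u p) := by
    obtain ⟨hx1, hx2⟩ := hab' x
    obtain ⟨hp1, hp2⟩ := hab' p
    rcases mul_self_eq_one_iff.1 hε with rfl | rfl <;> nlinarith
  have h7 := (mul_le_mul h2 (Real.exp_le_exp.2 h6) (Real.exp_pos _).le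
    ((inv_pos.2 hR).le.trans h2)).trans h3
  exact one_div_le_one_div_of_le
    (Real.sqrt_pos.2 (mul_pos (inv_pos.2 hR) (Real.exp_pos _))) (Real.sqrt_le_sqrt h7)

end GaussianSpacetime

theorem mainTheorem10 {n : ℕ} {S : Type*} [TopologicalSpace S] [T2Space S] [CompactSpace S]
    [ChartedSpace (EuclideanSpace ℝ (Fin n)) S] [IsManifold (𝓡 n) ∞ S]
    (N : GaussianSpacetime n S) (a b : ℝ) (hab : Set.Icc a b ⊆ N.I) (κ₀ : ℝ) :
    ∃ c : ℝ, ∀ u : S → ℝ, ContMDiff (𝓡 n) 𝓘(ℝ, ℝ) 2 u → (∀ x, u x ∈ Set.Icc a b) →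
      N.IsSpacelikeGraph u →
      ((∀ p κ, N.IsPrincipalCurvature u p κ → κ₀ ≤ κ) ∨
        (∀ p κ, N.IsPrincipalCurvature u p κ → κ ≤ κ₀)) →
      ∀ x, N.gradNormSq u x < 1 ∧ N.tiltFactor u x ≤ c := by
  obtain ⟨C, hC⟩ := N.exists_boundedBy hab
  -- `|κ₀|` bounds both `κ₀` and `-κ₀`, so one constant serves for `ε = 1` and `ε = -1`.
  refine ⟨1 / √((max 1 (|κ₀| * Real.exp C) ^ 2)⁻¹ * Real.exp (-(2 * (2 * C + 1) * (b - a)))),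
    fun u hu hu' hspace hκ x ↦
      ⟨GaussianSpacetime.gradNormSq_lt_one hu (fun x ↦ hab (hu' x)) hspace x, ?_⟩⟩
  rcases hκ with hκ | hκ
  · exact GaussianSpacetime.tiltFactor_le (ε := -1) (by norm_num) hab hC hu hu' hspace
      (fun p κ h ↦ by linarith [hκ p κ h, neg_abs_le κ₀]) x
  · exact GaussianSpacetime.tiltFactor_le (ε := 1) (by norm_num) hab hC hu hu' hspace
      (fun p κ h ↦ by linarith [hκ p κ h, le_abs_self κ₀]) x
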